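/- Let $k$ be an arbitrary commutative unital ring. **Jordan–Kantor pairs.** A *Jordan–Kantor pair* $P=(J,M)$ over $k$ consists of $k$-modules $J^+,J^-,M^+,M^-$ and, for each sign $\sigma=\pm$, a quadratic map $Q^\sigma\colon J^\sigma\to\operatorname{Hom}_k(J^{-\sigma},J^\sigma)$, a bilinear map $\circ\colon J^\sigma\times M^{-\sigma}\to M^\sigma$, a trilinear map $M^\sigma\times M^{-\sigma}\times M^\sigma\to M^\sigma$, $(x,y,z)\mapsto V_{x,y}z=\{x,y,z\}$, and a bilinear map $\kappa\colon M^\sigma\times M^\sigma\to J^\sigma$. Put $Q_{a,c}=Q_{a+c}-Q_a-Q_c$ and $D_{a,b}c=\{a,b,c\}=Q_{a,c}b$. For both signs $\sigma$ and all $a,c\in J^\sigma$, $b\in J^{-\sigma}$, $x,z,u\in M^\sigma$, $y,w\in M^{-\sigma}$ the following is required: 1. $D_{a,b}Q_a=Q_aD_{b,a}$, $\;D_{Q_ab,b}=D_{a,Q_ba}$, $\;Q_{Q_ab}=Q_aQ_bQ_a$, and these three identities hold in all scalar extensions of $k$ (that is, $J=(J^+,J^-)$ is a Jordan pair); 2.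 $\{a,b,c\}\circ y=a\circ(b\circ(c\circ y))+c\circ(b\circ(a\circ y))$; 3. $[V_{x,y},V_{z,w}]=V_{\{x,y,z\},w}-V_{z,\{y,x,w\}}$; 4. $\kappa(x,x)=0$; 5. $\kappa(x,z)\circ y=\{x,y,z\}-\{z,y,x\}$; 6. $\kappa(x,z)\circ(b\circ u)=\{z,b\circ x,u\}-\{x,b\circ z,u\}$; 7. $\kappa(b\circ x,y)\circ z=b\circ\{x,y,z\}+\{y,x,b\circ z\}$; 8. $\{\kappa(x,z),b,a\}=\kappa(a\circ(b\circ x),z)+\kappa(x,a\circ(b\circ z))$; 9. $\{a,\kappa(y,w),c\}=\kappa(a\circ w,c\circ y)+\kappa(c\circ w,a\circ y)$; 10. $\kappa(\kappa(z,u)\circ y,x)=\kappa(\{x,y,z\},u)+\kappa(z,\{x,y,u\})$. $P$ is *perfect* if, for both signs, $J^\sigma=\{J^\sigma,J^{-\sigma},J^\sigma\}+\kappa(M^\sigma,M^\sigma)$ and $M^\sigma=\{M^\sigma,M^{-\sigma},M^\sigma\}+J^\sigma\circ M^{-\sigma}$ (spans of all such products). **Inner derivations.** For $(a,b)\in J^+\times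 J^-$ and $(x,y)\in M^+\times M^-$ let $\delta(a,b)$ and $v(x,y)$ be the endomorphisms of $J^+\oplus M^+\oplus M^-\oplus J^-$ that preserve the four summands and are given by $$\delta(a,b)\colon\; c\mapsto\{a,b,c\},\quad z\mapsto a\circ(b\circ z),\quad w\mapsto -b\circ(a\circ w),\quad d\mapsto-\{b,a,d\},$$ $$v(x,y)\colon\; c\mapsto\kappa(c\circ y,x),\quad z\mapsto\{x,y,z\},\quad w\mapsto-\{y,x,w\},\quad d\mapsto-\kappa(d\circ x,y)$$ for $c\in J^+$, $z\in M^+$, $w\in M^-$, $d\in J^-$. Their span $\operatorname{instr}(P)$ is a Lie algebra under the commutator. **The Tits–Kantor–Koecher algebra.** $\operatorname{TKK}(P)=J^+\oplus M^+\oplus\operatorname{instr}(P)\oplus M^-\oplus J^-$ is the $\mathbb Z$-graded Lie algebra with these summands in degrees $2,1,0,-1,-2$ and bracket determined by $[a,b]=\delta(a,b)$, $[x,y]=v(x,y)$, $[a,y]=a\circ y$, $[b,x]=b\circ x$, $[x,z]=\kappa(x,z)$, $[y,w]=\kappa(y,w)$, $[T,p]=T.p$, the commutator on $\operatorname{instr}(P)$,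 and antisymmetry ($a\in J^+$, $b\in J^-$, $x,z\in M^+$, $y,w\in M^-$, $T\in\operatorname{instr}(P)$, $p$ in any of the other four summands); brackets whose degree is outside $\{-2,\dots,2\}$ are $0$. **The universal derivation algebra.** $\mathfrak{uider}(P)$ is the quotient of $(J^+\otimes J^-)\oplus(M^+\otimes M^-)$ by the submodule spanned by all $$x\otimes\{y,x,y\}-\{x,y,x\}\otimes y,\qquad \{x,y,u\}\otimes w+\{u,w,x\}\otimes y-u\otimes\{y,x,w\}-x\otimes\{w,u,y\},$$ $$a\otimes\{b,a,b\}-\{a,b,a\}\otimes b,\qquad \{a,b,c\}\otimes d-c\otimes\{b,a,d\}+\{c,d,a\}\otimes b-a\otimes\{b,c,d\},$$ $$\kappa(u,x)\otimes b-x\otimes(b\circ u)+u\otimes(b\circ x),\qquad a\otimes\kappa(y,w)-(a\circ y)\otimes w+(a\circ w)\otimes y$$ with $a,c\in J^+$, $b,d\in J^-$, $x,u\in M^+$, $y,w\in M^-$. The classes of $a\otimes b$ and $x\otimes y$ are written $a\diamond b$ and $x\diamond y$. There is a linear map $\operatorname{ud}\colon\mathfrak{uider}(P)\to\operatorname{instr}(P)$,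 $a\diamond b\mapsto\delta(a,b)$, $x\diamond y\mapsto v(x,y)$; the algebra $\operatorname{instr}(P)$ acts on $\mathfrak{uider}(P)$ by $T.(a\diamond b)=T.a\diamond b+a\diamond T.b$, $T.(x\diamond y)=T.x\diamond y+x\diamond T.y$; and $[p,q]=\operatorname{ud}(p).q$ makes $\mathfrak{uider}(P)$ a Lie algebra and $\operatorname{ud}$ a homomorphism. The *cyclic homology* of $P$ is $$\mathrm{HC}(P)=\Big\{\sum_i a_i\diamond b_i+\sum_j x_j\diamond y_j:\ \sum_i\delta(a_i,b_i)+\sum_j v(x_j,y_j)=0\Big\}=\ker(\operatorname{ud}).$$ **Universal central extension.** For a Lie algebra $L$ over $k$ let $\mathfrak{uce}(L)$ be the quotient of $L\wedge L$ by the span of all $p\wedge[q,r]+q\wedge[r,p]+r\wedge[p,q]$; let $\langle p,q\rangle$ be the class of $p\wedge q$, let $u\colon\mathfrak{uce}(L)\to L$, $\langle p,q\rangle\mapsto[p,q]$, and let $[X,Y]=\langle u(X),u(Y)\rangle$. If $L$ is graded by $\mathbb Z$, then $\mathfrak{uce}(L)$ is graded by $\mathfrak{uce}(L)_n=\sum_{m\in\mathbb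 Z}\langle L_m,L_{n-m}\rangle$. **Theorem.** Let $P$ be a perfect Jordan–Kantor pair over $k$ and let $L=\operatorname{TKK}(P)$ with its $\mathbb Z$-grading. Then there is an isomorphism of Lie algebras over $k$ $$\varphi\colon\mathfrak{uce}(L)_0\longrightarrow\mathfrak{uider}(P)$$ with $\varphi(\langle a,b\rangle)=a\diamond b$ for all $(a,b)\in J^+\times J^-$ and $\varphi(\langle x,y\rangle)=x\diamond y$ for all $(x,y)\in M^+\times M^-$. Moreover, $\varphi$ restricts to an isomorphism $$(\ker u)_0=\ker u\cap\mathfrak{uce}(L)_0\;\cong\;\mathrm{HC}(P).$$ -/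

import Mathlib

open scoped TensorProduct

namespace JKP

/-- A quadratic map from a `k`-module to a `K`-module extends uniquely to a quadratic map over the
extension ring `K`. -/
theorem exists_unique_quadraticExtend {k M N : Type*} [CommRing k] [AddCommGroup M] [Module k M]
    (K : Type*) [CommRing K] [Algebra k K] [AddCommGroup N] [Module k N] [Module K N]
    [IsScalarTower k K N] (Q : QuadraticMap k M N) :
    ∃! q : QuadraticMap K (K ⊗[k] M) N, ∀ m, q (1 ⊗ₜ m) = Q m := by
  refine existsUnique_of_exists_of_unique ?_
    (fun q₁ q₂ h₁ h₂ => baseChange_ext fun m => by rw [h₁, h₂])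
  let pi : (M →₀ k) →ₗ[k] M := Finsupp.linearCombination k id
  have hpi : Function.Surjective pi := fun m => ⟨Finsupp.single m 1, by simp [pi]⟩
  obtain ⟨B, hB⟩ := LinearMap.BilinMap.toQuadraticMap_surjective (Q.comp pi)
  have hB' : ∀ f, B f f = Q (pi f) := fun f => by
    have := congrArg (fun q => q f) hB; simpa using this
  have hBp : ∀ f g, pi f = 0 → B f g + B g f = 0 := fun f g hf => by
    have h1 := hB' (f + g)
    simp only [map_add, LinearMap.add_apply, hB', hf, zero_add, QuadraticMap.map_zero] at h1
    have : (B g f + B f g) + Q (pi g) = Q (pi g) := by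
      rw [add_assoc]; exact h1
    rw [add_comm]; simpa using this
  let BK : K ⊗[k] (M →₀ k) →ₗ[K] K ⊗[k] (M →₀ k) →ₗ[K] N :=
    LinearMap.liftBaseChange K
      (((LinearMap.liftBaseChangeEquiv K (M := (M →₀ k)) (N := N)).toLinearMap.restrictScalars k) ∘ₗ B)
  have hBK : ∀ s f t g, BK (s ⊗ₜ f) (t ⊗ₜ g) = (s * t) • B f g := by
    intro s f t g; simp [BK, mul_smul]
  let p : K ⊗[k] (M →₀ k) →ₗ[K] K ⊗[k] M := pi.baseChange K
  have hp : Function.Surjective p := LinearMap.lTensor_surjective K hpi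
  have hker : ∀ z, p z = 0 → ∃ w : K ⊗[k] (LinearMap.ker pi), (LinearMap.ker pi).subtype.lTensor K w = z := by
    intro z hz
    have := lTensor_exact (R := k) (M := LinearMap.ker pi) (N := M →₀ k) (P := M) K
      (LinearMap.exact_subtype_ker_map pi) hpi
    exact (this z).1 hz
  have hpol : ∀ (w : K ⊗[k] (LinearMap.ker pi)) y,
      BK ((LinearMap.ker pi).subtype.lTensor K w) y + BK y ((LinearMap.ker pi).subtype.lTensor K w) = 0 := by
    intro w y
    induction w with
    | zero => simp
    | add a b ha hb =>
      simp only [map_add, LinearMap.add_apply]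
      rw [← add_zero (0 : N)]; nth_rewrite 1 [← ha]; rw [← hb]; abel
    | tmul s f =>
      induction y with
      | zero => simp
      | add a b ha hb =>
        simp only [map_add, LinearMap.add_apply]
        rw [← add_zero (0 : N)]; nth_rewrite 1 [← ha]; rw [← hb]; abel
      | tmul t g =>
        rw [LinearMap.lTensor_tmul, hBK, hBK, mul_comm t s, ← smul_add, Submodule.subtype_apply,
          hBp _ _ f.2, smul_zero]
  have hdiag : ∀ (w : K ⊗[k] (LinearMap.ker pi)),
      BK ((LinearMap.ker pi).subtype.lTensor K w) ((LinearMap.ker pi).subtype.lTensor K w) = 0 := by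
    intro w
    induction w with
    | zero => simp
    | add a b ha hb =>
      simp only [map_add, LinearMap.add_apply]
      have := hpol a ((LinearMap.ker pi).subtype.lTensor K b)
      rw [ha, hb, zero_add, add_zero, add_comm]; exact this
    | tmul s f =>
      rw [LinearMap.lTensor_tmul, hBK, Submodule.subtype_apply, hB', f.2, QuadraticMap.map_zero, smul_zero]
  have hwd : ∀ z z', p z = p z' → BK z z = BK z' z' := by
    intro z z' h
    obtain ⟨w, hw⟩ := hker (z - z') (by rw [map_sub, h, sub_self])
    have e : z = z' + (LinearMap.ker pi).subtype.lTensor K w := by rw [hw]; abel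
    rw [e]
    simp only [map_add, LinearMap.add_apply, hdiag, add_zero]
    rw [add_assoc, hpol, add_zero]
  let s := Function.surjInv hp
  have hs : ∀ x, p (s x) = x := Function.surjInv_eq hp
  have key : ∀ z, BK (s (p z)) (s (p z)) = BK z z := fun z => hwd _ _ (hs _)
  refine ⟨QuadraticMap.ofPolar (fun x => BK (s x) (s x)) ?_ ?_ ?_, ?_⟩
  · intro a x
    obtain ⟨z, rfl⟩ := hp x
    rw [← map_smul, key, key]; simp [mul_smul]
  · intro x x' y
    obtain ⟨z, rfl⟩ := hp x
    obtain ⟨z', rfl⟩ := hp x'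
    obtain ⟨v, rfl⟩ := hp y
    simp only [QuadraticMap.polar, ← map_add p, key]
    simp only [map_add, LinearMap.add_apply]; abel
  · intro a x y
    obtain ⟨z, rfl⟩ := hp x
    obtain ⟨v, rfl⟩ := hp y
    simp only [QuadraticMap.polar, ← map_add p, ← map_smul p, key]
    simp only [map_add, map_smul, LinearMap.add_apply, LinearMap.smul_apply, smul_sub, smul_add]; abel
  · intro m
    have : (1 : K) ⊗ₜ[k] m = p (1 ⊗ₜ Finsupp.single m 1) := by simp [p, pi]
    change BK (s _) (s _) = _
    rw [this, key, hBK, hB']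
    simp [pi]

section
variable {k V W : Type*} [CommRing k] [AddCommGroup V] [Module k V] [AddCommGroup W] [Module k W]

/-- The trilinear product `D_{a,b} c = {a, b, c} = Q_{a,c} b`, where `Q_{a,c} = Q_{a+c} - Q_a - Q_c`. -/
noncomputable def qTriple (Q : QuadraticMap k V (W →ₗ[k] V)) : V →ₗ[k] W →ₗ[k] V →ₗ[k] V :=
  LinearMap.lflip.toLinearMap ∘ₗ Q.polarBilin
/-- The scalar extension to `K` of a quadratic map `Q : V → Hom(W, V)`: the unique `K`-quadratic map
with `Q_K (1 ⊗ a) = K ⊗ Q a`. -/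
noncomputable def qExtend (K : Type*) [CommRing K] [Algebra k K] (Q : QuadraticMap k V (W →ₗ[k] V)) :
    QuadraticMap K (K ⊗[k] V) (K ⊗[k] W →ₗ[K] K ⊗[k] V) :=
  (exists_unique_quadraticExtend (N := K ⊗[k] W →ₗ[K] K ⊗[k] V) K
    ((LinearMap.baseChangeHom k K W V).compQuadraticMap Q)).choose

theorem qExtend_one_tmul (K : Type*) [CommRing K] [Algebra k K]
    (Q : QuadraticMap k V (W →ₗ[k] V)) (a : V) :
    qExtend K Q (1 ⊗ₜ a) = (Q a).baseChange K := by
  have h := (exists_unique_quadraticExtend (N := K ⊗[k] W →ₗ[K] K ⊗[k] V) K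
    ((LinearMap.baseChangeHom k K W V).compQuadraticMap Q)).choose_spec.1 a
  exact h

theorem qTriple_apply (Q : QuadraticMap k V (W →ₗ[k] V)) (a c : V) (b : W) :
    qTriple Q a b c = Q (a + c) b - Q a b - Q c b := by
  simp [qTriple, QuadraticMap.polar]

theorem qTriple_comm (Q : QuadraticMap k V (W →ₗ[k] V)) (a c : V) (b : W) :
    qTriple Q a b c = qTriple Q c b a := by
  rw [qTriple_apply, qTriple_apply, add_comm a c]; abel

theorem q_add (Q : QuadraticMap k V (W →ₗ[k] V)) (a c : V) (b : W) :
    Q (a + c) b = Q a b + Q c b + qTriple Q a b c := by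
  rw [qTriple_apply]; abel

/-- One half of the defining identities of a Jordan pair, for elements of modules over `k` itself. -/
structure JordanIdentities (Qp : QuadraticMap k V (W →ₗ[k] V)) (Qm : QuadraticMap k W (V →ₗ[k] W)) :
    Prop where
  jp1 : ∀ a b, qTriple Qp a b ∘ₗ Qp a = Qp a ∘ₗ qTriple Qm b a
  jp2 : ∀ a b, qTriple Qp (Qp a b) b = qTriple Qp a (Qm b a)
  jp3 : ∀ a b, Qp (Qp a b) = Qp a ∘ₗ Qm b ∘ₗ Qp a
end

universe u
section
variable {k : Type u} {V W : Type*} [CommRing k] [AddCommGroup V] [Module k V] [AddCommGroup W]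
  [Module k W]

/-- `(V, W)` with the quadratic maps `Qp`, `Qm` is a Jordan pair: the identities hold, for both signs,
in all scalar extensions of `k`. (The universe of `k` contains all polynomial rings over `k`, so the
identities then hold over every extension, in whatever universe.) -/
structure IsJordanPair (Qp : QuadraticMap k V (W →ₗ[k] V)) (Qm : QuadraticMap k W (V →ₗ[k] W)) :
    Prop where
  plus : ∀ (K : Type u) [CommRing K] [Algebra k K],
    JordanIdentities (qExtend K Qp) (qExtend K Qm)
  minus : ∀ (K : Type u) [CommRing K] [Algebra k K],
    JordanIdentities (qExtend K Qm) (qExtend K Qp)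

variable {Qp : QuadraticMap k V (W →ₗ[k] V)} {Qm : QuadraticMap k W (V →ₗ[k] W)}

theorem IsJordanPair.symm (h : IsJordanPair Qp Qm) : IsJordanPair Qm Qp := ⟨h.minus, h.plus⟩

theorem qTriple_qExtend (K : Type*) [CommRing K] [Algebra k K] (Q : QuadraticMap k V (W →ₗ[k] V))
    (r s t : K) (a c : V) (b : W) :
    qTriple (qExtend K Q) (r ⊗ₜ a) (s ⊗ₜ b) (t ⊗ₜ c) = (r * s * t) ⊗ₜ qTriple Q a b c := by
  have h1 : qTriple (qExtend K Q) (1 ⊗ₜ a) (1 ⊗ₜ b) (1 ⊗ₜ c) = 1 ⊗ₜ qTriple Q a b c := by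
    rw [qTriple_apply, qTriple_apply, ← TensorProduct.tmul_add, qExtend_one_tmul, qExtend_one_tmul,
      qExtend_one_tmul]
    simp [TensorProduct.tmul_sub]
  have e : ∀ {X : Type _} [AddCommGroup X] [Module k X] (r : K) (x : X),
      r ⊗ₜ[k] x = r • ((1 : K) ⊗ₜ[k] x) := fun r x => by
    rw [TensorProduct.smul_tmul', smul_eq_mul, mul_one]
  rw [e r a, e t c, TensorProduct.tmul_eq_smul_one_tmul s b]
  simp only [map_smul, LinearMap.smul_apply, h1, smul_smul]
  rw [TensorProduct.smul_tmul', smul_eq_mul, mul_one]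
  congr 1; ring

theorem IsJordanPair.jp2 (h : IsJordanPair Qp Qm) (a : V) (b : W) (c : V) :
    qTriple Qp (Qp a b) b c = qTriple Qp a (Qm b a) c := by
  have := congrArg (fun f => TensorProduct.lid k V (f (1 ⊗ₜ c))) ((h.plus k).jp2 (1 ⊗ₜ a) (1 ⊗ₜ b))
  simpa [qExtend_one_tmul, qTriple_qExtend] using this

theorem IsJordanPair.jp2' (h : IsJordanPair Qp Qm) (x z w : V) (y v : W) :
    qTriple Qp (qTriple Qp x y z) v w + qTriple Qp (qTriple Qp x v z) y w =
      qTriple Qp x (qTriple Qm y z v) w + qTriple Qp z (qTriple Qm y x v) w := by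
  have h1 : ∀ x z y, qTriple Qp (qTriple Qp x y z) y w =
      qTriple Qp x (Qm y z) w + qTriple Qp z (Qm y x) w := fun x z y => by
    have e := h.jp2 (x + z) y w
    simp only [q_add, map_add, LinearMap.add_apply, h.jp2] at e
    linear_combination (norm := module) e
  have e := h1 x z (y + v)
  simp only [q_add, map_add, LinearMap.add_apply, h1] at e
  linear_combination (norm := module) e

theorem IsJordanPair.jp1' (h : IsJordanPair Qp Qm) (a c : V) (b w : W) :
    qTriple Qp a b (qTriple Qp a w c) + qTriple Qp c b (Qp a w) =
      qTriple Qp a (qTriple Qm b a w) c + Qp a (qTriple Qm b c w) := by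
  have e := congrArg (fun f => TensorProduct.lid k V
    ((Polynomial.lcoeff k 1).rTensor V (f (1 ⊗ₜ w))))
    ((h.plus (Polynomial k)).jp1 (1 ⊗ₜ a + Polynomial.X ⊗ₜ c) (1 ⊗ₜ b))
  have hX : qExtend (Polynomial k) Qp (Polynomial.X ⊗ₜ[k] c) =
      (Polynomial.X * Polynomial.X : Polynomial k) • (Qp c).baseChange (Polynomial k) := by
    rw [← qExtend_one_tmul, ← QuadraticMap.map_smul, TensorProduct.smul_tmul', smul_eq_mul, mul_one]
  simp only [LinearMap.comp_apply, q_add, hX, qExtend_one_tmul, map_add, LinearMap.add_apply,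
    qTriple_qExtend, LinearMap.smul_apply, LinearMap.baseChange_tmul,
    TensorProduct.smul_tmul', LinearMap.rTensor_tmul, TensorProduct.lid_tmul] at e
  simp [Polynomial.coeff_X, Polynomial.coeff_one, ← pow_two, Polynomial.coeff_X_pow] at e
  linear_combination (norm := module) e

/-- The fundamental five-linear identity of a Jordan pair. -/
theorem IsJordanPair.five_linear (h : IsJordanPair Qp Qm) (x u z : V) (y v : W) :
    qTriple Qp x y (qTriple Qp u v z) = qTriple Qp (qTriple Qp x y u) v z
      - qTriple Qp u (qTriple Qm y x v) z + qTriple Qp u v (qTriple Qp x y z) := by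
  have e1 := h.jp1' (x + u) z v y
  have e2 := h.jp1' x z v y
  have e3 := h.jp1' u z v y
  have f1 := h.jp2' u z x y v
  simp only [q_add, map_add, LinearMap.add_apply, qTriple_comm Qm v y] at e1 e2 e3
  rw [qTriple_comm Qp (qTriple Qp u y z) x v, qTriple_comm Qp (qTriple Qp u v z) x y,
    qTriple_comm Qp u x, qTriple_comm Qp z x] at f1
  rw [qTriple_comm Qp (qTriple Qp x y u) z v]
  linear_combination (norm := module) f1 - e1 + e2 + e3
end

section uce
variable (k L : Type*) [CommRing k] [LieRing L] [LieAlgebra k L]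

/-- `x ∧ y` -/
noncomputable def wedge (x y : L) : ⋀[k]^2 L := exteriorPower.ιMulti k 2 ![x, y]

/-- The relations `x ∧ [y, z] + y ∧ [z, x] + z ∧ [x, y]`. -/
noncomputable def uceRel : Submodule k (⋀[k]^2 L) :=
  Submodule.span k {t | ∃ x y z : L,
    t = wedge k L x ⁅y, z⁆ + wedge k L y ⁅z, x⁆ + wedge k L z ⁅x, y⁆}

/-- The module `uce(L) = (L ∧ L) / ⟨x ∧ [y, z] + y ∧ [z, x] + z ∧ [x, y]⟩`; its Lie bracket is defined
below. -/
def Uce : Type _ := (⋀[k]^2 L) ⧸ uceRel k L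

noncomputable instance : AddCommGroup (Uce k L) := inferInstanceAs (AddCommGroup (_ ⧸ uceRel k L))
noncomputable instance : Module k (Uce k L) := inferInstanceAs (Module k (_ ⧸ uceRel k L))

theorem wedge_add_left (x x' y : L) : wedge k L (x + x') y = wedge k L x y + wedge k L x' y := by
  have := (exteriorPower.ιMulti k 2 (M := L)).map_update_add ![0, y] 0 x x'
  have e : ∀ t : L, Function.update ![0, y] 0 t = ![t, y] := fun t => by
    ext i; fin_cases i <;> rfl
  rwa [e, e, e] at this

theorem wedge_add_right (x y y' : L) : wedge k L x (y + y') = wedge k L x y + wedge k L x y' := by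
  have := (exteriorPower.ιMulti k 2 (M := L)).map_update_add ![x, 0] 1 y y'
  have e : ∀ t : L, Function.update ![x, 0] 1 t = ![x, t] := fun t => by
    ext i; fin_cases i <;> rfl
  rwa [e, e, e] at this

theorem wedge_smul_left (r : k) (x y : L) : wedge k L (r • x) y = r • wedge k L x y := by
  have := (exteriorPower.ιMulti k 2 (M := L)).map_update_smul ![0, y] 0 r x
  have e : ∀ t : L, Function.update ![0, y] 0 t = ![t, y] := fun t => by
    ext i; fin_cases i <;> rfl
  rwa [e, e] at this

theorem wedge_smul_right (r : k) (x y : L) : wedge k L x (r • y) = r • wedge k L x y := by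
  have := (exteriorPower.ιMulti k 2 (M := L)).map_update_smul ![x, 0] 1 r y
  have e : ∀ t : L, Function.update ![x, 0] 1 t = ![x, t] := fun t => by
    ext i; fin_cases i <;> rfl
  rwa [e, e] at this

theorem wedge_self (x : L) : wedge k L x x = 0 :=
  (exteriorPower.ιMulti k 2 (M := L)).map_eq_zero_of_eq ![x, x] (i := 0) (j := 1) rfl (by simp)

variable {L} in
/-- `⟨x, y⟩`, the class of `x ∧ y`. -/
noncomputable def ang : L →ₗ[k] L →ₗ[k] Uce k L :=
  LinearMap.mk₂ k (fun x y => (uceRel k L).mkQ (wedge k L x y))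
    (fun x x' y => by rw [wedge_add_left]; exact map_add _ _ _)
    (fun r x y => by rw [wedge_smul_left]; exact map_smul _ _ _)
    (fun x y y' => by rw [wedge_add_right]; exact map_add _ _ _)
    (fun r x y => by rw [wedge_smul_right]; exact map_smul _ _ _)

variable {L}
theorem ang_self (x : L) : ang k x x = 0 := by
  change (uceRel k L).mkQ (wedge k L x x) = 0
  rw [wedge_self, map_zero]

theorem ang_jacobi (x y z : L) : ang k x ⁅y, z⁆ + ang k y ⁅z, x⁆ + ang k z ⁅x, y⁆ = 0 := by
  change (uceRel k L).mkQ (wedge k L x ⁅y, z⁆) + (uceRel k L).mkQ (wedge k L y ⁅z, x⁆) +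
    (uceRel k L).mkQ (wedge k L z ⁅x, y⁆) = 0
  rw [← map_add, ← map_add]
  exact (Submodule.Quotient.mk_eq_zero _).2 (Submodule.subset_span ⟨x, y, z, rfl⟩)

theorem ang_skew (x y : L) : ang k x y = -ang k y x := by
  have h := ang_self k (x + y)
  simp only [map_add, LinearMap.add_apply, ang_self, zero_add, add_zero] at h
  exact eq_neg_of_add_eq_zero_right h

variable (L) in
/-- The bracket as an alternating map. -/
noncomputable def lieAlt : L [⋀^Fin 2]→ₗ[k] L where
  toFun v := ⁅v 0, v 1⁆
  map_update_add' v i x y := by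
    fin_cases i <;> simp [Function.update]
  map_update_smul' v i r x := by
    fin_cases i <;> simp [Function.update]
  map_eq_zero_of_eq' v i j h hij := by
    fin_cases i <;> fin_cases j <;> simp_all

variable (L) in
/-- The linear map `⟨x, y⟩ ↦ [x, y]`. -/
noncomputable def uceLin : Uce k L →ₗ[k] L :=
  (uceRel k L).liftQ (exteriorPower.alternatingMapLinearEquiv (lieAlt k L)) (by
    rw [uceRel, Submodule.span_le]
    rintro _ ⟨x, y, z, rfl⟩
    simpa [wedge, lieAlt] using lie_jacobi x y z)

@[simp] theorem uceLin_ang (x y : L) : uceLin k L (ang k x y) = ⁅x, y⁆ := by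
  change (uceRel k L).liftQ _ _ ((uceRel k L).mkQ (wedge k L x y)) = _
  simp [wedge, lieAlt]

/-- The Lie bracket `[X, Y] = ⟨u(X), u(Y)⟩` of `uce(L)`. -/
noncomputable instance : LieRing (Uce k L) where
  bracket X Y := ang k (uceLin k L X) (uceLin k L Y)
  add_lie X Y Z := by
    change ang k _ _ = ang k _ _ + ang k _ _
    rw [map_add, map_add, LinearMap.add_apply]
  lie_add X Y Z := by
    change ang k _ _ = ang k _ _ + ang k _ _
    rw [map_add, map_add]
  lie_self X := ang_self k _
  leibniz_lie X Y Z := by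
    change ang k _ (uceLin k L (ang k _ _)) =
      ang k (uceLin k L (ang k _ _)) _ + ang k _ (uceLin k L (ang k _ _))
    simp only [uceLin_ang]
    have h := ang_jacobi k (uceLin k L X) (uceLin k L Y) (uceLin k L Z)
    rw [ang_skew k ⁅uceLin k L X, uceLin k L Y⁆, ← lie_skew (uceLin k L Z) (uceLin k L X), map_neg]
      at *
    linear_combination (norm := module) h

noncomputable instance : LieAlgebra k (Uce k L) where
  lie_smul r X Y := by
    change ang k _ _ = r • ang k _ _
    rw [map_smul, map_smul]

variable (L) in
/-- The homomorphism `u : uce(L) → L`, `⟨x, y⟩ ↦ [x, y]`. -/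
noncomputable def uceMap : Uce k L →ₗ⁅k⁆ L where
  __ := uceLin k L
  map_lie' := uceLin_ang k _ _

section grading
variable {k} {Γ : Type*} [AddCommGroup Γ] (G : Γ → Submodule k L)

/-- The grading of `uce(L)` obtained from a grading of `L`: `uce(L)_γ = ∑_δ ⟨L_δ, L_{γ - δ}⟩`. -/
noncomputable def uceGrading (γ : Γ) : Submodule k (Uce k L) :=
  ⨆ δ : Γ, Submodule.span k {X | ∃ x ∈ G δ, ∃ y ∈ G (γ - δ), X = ang k x y}

theorem uceMap_mem [SetLike.GradedBracket G] {γ : Γ} {X : Uce k L} (hX : X ∈ uceGrading G γ) :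
    uceMap k L X ∈ G γ := by
  have : uceGrading G γ ≤ (G γ).comap (uceMap k L : Uce k L →ₗ[k] L) := by
    refine iSup_le fun δ => ?_
    rw [Submodule.span_le]
    rintro _ ⟨x, hx, y, hy, rfl⟩
    have := SetLike.GradedBracket.bracket_mem (ℒ := G) hx hy
    rw [add_sub_cancel] at this
    change uceLin k L (ang k x y) ∈ G γ
    rwa [uceLin_ang]
  exact this hX

theorem uce_bracket_mem [SetLike.GradedBracket G] {γ γ' : Γ} {X Y : Uce k L}
    (hX : X ∈ uceGrading G γ) (hY : Y ∈ uceGrading G γ') : ⁅X, Y⁆ ∈ uceGrading G (γ + γ') :=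
  Submodule.mem_iSup_of_mem γ (Submodule.subset_span
    ⟨_, uceMap_mem G hX, _, by rw [add_sub_cancel_left]; exact uceMap_mem G hY, rfl⟩)

/-- The Lie subalgebra `uce(L)₀`. -/
noncomputable def uceZero [SetLike.GradedBracket G] : LieSubalgebra k (Uce k L) where
  __ := uceGrading G 0
  lie_mem' {X Y} hX hY := by
    have := uce_bracket_mem G hX hY
    rw [add_zero] at this
    exact this

theorem ang_mem_uceZero [SetLike.GradedBracket G] (δ : Γ) {x y : L} (hx : x ∈ G δ)
    (hy : y ∈ G (-δ)) : ang k x y ∈ uceZero G :=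
  Submodule.mem_iSup_of_mem δ (Submodule.subset_span ⟨x, hx, y, by rwa [zero_sub], rfl⟩)
/-- `(ker u)₀`, the degree `0` part of the kernel of `u : uce(L) → L`. -/
noncomputable def uceKerZero [SetLike.GradedBracket G] : LieSubalgebra k (Uce k L) :=
  (uceMap k L).ker.toLieSubalgebra ⊓ uceZero G

theorem mem_uceZero_of_mem [SetLike.GradedBracket G] {X : Uce k L} (hX : X ∈ uceKerZero G) :
    X ∈ uceZero G := (LieSubalgebra.mem_inf _ _ _).1 hX |>.2
end grading
end uce

/-- The operations of a Jordan-Kantor pair: `Qp`, `Qm` are the quadratic maps of `J`, `actp a y` and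
`actm b x` are `a ∘ y` and `b ∘ x`, `Vp x y z` and `Vm y x w` are `{x, y, z}` and `{y, x, w}`, and
`kp`, `km` are the two maps `κ`. -/
structure JordanKantorData (k Jp Jm Mp Mm : Type*) [CommRing k]
    [AddCommGroup Jp] [Module k Jp] [AddCommGroup Jm] [Module k Jm]
    [AddCommGroup Mp] [Module k Mp] [AddCommGroup Mm] [Module k Mm] where
  Qp : QuadraticMap k Jp (Jm →ₗ[k] Jp)
  Qm : QuadraticMap k Jm (Jp →ₗ[k] Jm)
  actp : Jp →ₗ[k] Mm →ₗ[k] Mp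
  actm : Jm →ₗ[k] Mp →ₗ[k] Mm
  Vp : Mp →ₗ[k] Mm →ₗ[k] Mp →ₗ[k] Mp
  Vm : Mm →ₗ[k] Mp →ₗ[k] Mm →ₗ[k] Mm
  kp : Mp →ₗ[k] Mp →ₗ[k] Jp
  km : Mm →ₗ[k] Mm →ₗ[k] Jm

section
variable {k : Type u} {Jp Jm Mp Mm : Type*} [CommRing k]
    [AddCommGroup Jp] [Module k Jp] [AddCommGroup Jm] [Module k Jm]
    [AddCommGroup Mp] [Module k Mp] [AddCommGroup Mm] [Module k Mm]

/-- The roles of `+` and `-` exchanged. -/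
def JordanKantorData.op (P : JordanKantorData k Jp Jm Mp Mm) : JordanKantorData k Jm Jp Mm Mp where
  Qp := P.Qm
  Qm := P.Qp
  actp := P.actm
  actm := P.actp
  Vp := P.Vm
  Vm := P.Vp
  kp := P.km
  km := P.kp

/-- `Dp a b c = {a, b, c}` on `J⁺`. -/
noncomputable abbrev JordanKantorData.Dp (P : JordanKantorData k Jp Jm Mp Mm) :
    Jp →ₗ[k] Jm →ₗ[k] Jp →ₗ[k] Jp := qTriple P.Qp

/-- `Dm b a d = {b, a, d}` on `J⁻`. -/
noncomputable abbrev JordanKantorData.Dm (P : JordanKantorData k Jp Jm Mp Mm) :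
    Jm →ₗ[k] Jp →ₗ[k] Jm →ₗ[k] Jm := qTriple P.Qm

/-- The multilinear identities of a Jordan-Kantor pair, for the sign `σ = +`. -/
structure JordanKantorIdentities (P : JordanKantorData k Jp Jm Mp Mm) : Prop where
  special : ∀ a c b y, P.actp (P.Dp a b c) y =
    P.actp a (P.actm b (P.actp c y)) + P.actp c (P.actm b (P.actp a y))
  V_V : ∀ x y z w u, P.Vp x y (P.Vp z w u) - P.Vp z w (P.Vp x y u) =
    P.Vp (P.Vp x y z) w u - P.Vp z (P.Vm y x w) u
  k_self : ∀ x, P.kp x x = 0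
  k_act : ∀ x z y, P.actp (P.kp x z) y = P.Vp x y z - P.Vp z y x
  k_act_act : ∀ x z b u, P.actp (P.kp x z) (P.actm b u) =
    P.Vp z (P.actm b x) u - P.Vp x (P.actm b z) u
  k_act_left : ∀ b x y z, P.actm (P.km (P.actm b x) y) z =
    P.actm b (P.Vp x y z) + P.Vm y x (P.actm b z)
  D_k_left : ∀ x z b a, P.Dp (P.kp x z) b a =
    P.kp (P.actp a (P.actm b x)) z + P.kp x (P.actp a (P.actm b z))
  D_k_mid : ∀ a c y w, P.Dp a (P.km y w) c =
    P.kp (P.actp a w) (P.actp c y) + P.kp (P.actp c w) (P.actp a y)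
  k_k : ∀ z u y x, P.kp (P.actp (P.kp z u) y) x = P.kp (P.Vp x y z) u + P.kp z (P.Vp x y u)

end

/-- A Jordan-Kantor pair `((J⁺, J⁻), (M⁺, M⁻))` over `k`. -/
structure JordanKantorPair (k : Type u) (Jp Jm Mp Mm : Type*) [CommRing k]
    [AddCommGroup Jp] [Module k Jp] [AddCommGroup Jm] [Module k Jm]
    [AddCommGroup Mp] [Module k Mp] [AddCommGroup Mm] [Module k Mm]
    extends JordanKantorData k Jp Jm Mp Mm where
  jordan : IsJordanPair Qp Qm
  plus : JordanKantorIdentities toJordanKantorData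
  minus : JordanKantorIdentities toJordanKantorData.op

/-- The ring of `k`-endomorphisms of `P = J⁺ ⊕ M⁺ ⊕ M⁻ ⊕ J⁻` that preserve the `5`-grading, written as
block diagonal endomorphisms `(T₂, T₁, T₋₁, T₋₂)`. It is a Lie algebra under the commutator. -/
abbrev BlockEnd (k Jp Mp Mm Jm : Type*) [CommRing k]
    [AddCommGroup Jp] [Module k Jp] [AddCommGroup Jm] [Module k Jm]
    [AddCommGroup Mp] [Module k Mp] [AddCommGroup Mm] [Module k Mm] : Type _ :=
  Module.End k Jp × Module.End k Mp × Module.End k Mm × Module.End k Jm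

noncomputable instance (k Jp Mp Mm Jm : Type*) [CommRing k]
    [AddCommGroup Jp] [Module k Jp] [AddCommGroup Jm] [Module k Jm]
    [AddCommGroup Mp] [Module k Mp] [AddCommGroup Mm] [Module k Mm] :
    LieRing (BlockEnd k Jp Mp Mm Jm) := LieRing.ofAssociativeRing

noncomputable instance (k Jp Mp Mm Jm : Type*) [CommRing k]
    [AddCommGroup Jp] [Module k Jp] [AddCommGroup Jm] [Module k Jm]
    [AddCommGroup Mp] [Module k Mp] [AddCommGroup Mm] [Module k Mm] :
    LieAlgebra k (BlockEnd k Jp Mp Mm Jm) := LieAlgebra.ofAssociativeAlgebra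

namespace JordanKantorPair
variable {k : Type u} {Jp Jm Mp Mm : Type*} [CommRing k]
    [AddCommGroup Jp] [Module k Jp] [AddCommGroup Jm] [Module k Jm]
    [AddCommGroup Mp] [Module k Mp] [AddCommGroup Mm] [Module k Mm]
    (P : JordanKantorPair k Jp Jm Mp Mm)

/-- The opposite Jordan-Kantor pair. -/
def op : JordanKantorPair k Jm Jp Mm Mp where
  toJordanKantorData := P.toJordanKantorData.op
  jordan := P.jordan.symm
  plus := P.minus
  minus := P.plus

/-- `δ(a, b)`: `D_{a,b}` on `J⁺`, `x ↦ a ∘ (b ∘ x)` on `M⁺`, `y ↦ -b ∘ (a ∘ y)` on `M⁻`, `-D_{b,a}` on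
`J⁻`. -/
noncomputable def delta : Jp →ₗ[k] Jm →ₗ[k] BlockEnd k Jp Mp Mm Jm :=
  LinearMap.mk₂ k
    (fun a b => (P.Dp a b, P.actp a ∘ₗ P.actm b, -(P.actm b ∘ₗ P.actp a), -P.Dm b a))
    (by intros; ext <;> simp <;> abel) (by intros; ext <;> simp)
    (by intros; ext <;> simp <;> abel) (by intros; ext <;> simp)

/-- `v(x, y)`: `a ↦ κ(a ∘ y, x)` on `J⁺`, `V_{x,y}` on `M⁺`, `-V_{y,x}` on `M⁻`, `b ↦ -κ(b ∘ x, y)` on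
`J⁻`. -/
noncomputable def upsilon : Mp →ₗ[k] Mm →ₗ[k] BlockEnd k Jp Mp Mm Jm :=
  LinearMap.mk₂ k
    (fun x y => (P.kp.flip x ∘ₗ P.actp.flip y, P.Vp x y, -P.Vm y x,
      -(P.km.flip y ∘ₗ P.actm.flip x)))
    (by intros; ext <;> simp <;> abel) (by intros; ext <;> simp)
    (by intros; ext <;> simp <;> abel) (by intros; ext <;> simp)

section
variable (a c : Jp) (b d : Jm) (x z : Mp) (y w : Mm)
@[simp] theorem delta_2 : (P.delta a b).1 c = P.Dp a b c := rfl
@[simp] theorem delta_1 : (P.delta a b).2.1 x = P.actp a (P.actm b x) := rfl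
@[simp] theorem delta_m1 : (P.delta a b).2.2.1 y = -P.actm b (P.actp a y) := rfl
@[simp] theorem delta_m2 : (P.delta a b).2.2.2 d = -P.Dm b a d := rfl
@[simp] theorem upsilon_2 : (P.upsilon x y).1 a = P.kp (P.actp a y) x := rfl
@[simp] theorem upsilon_1 : (P.upsilon x y).2.1 z = P.Vp x y z := rfl
@[simp] theorem upsilon_m1 : (P.upsilon x y).2.2.1 w = -P.Vm y x w := rfl
@[simp] theorem upsilon_m2 : (P.upsilon x y).2.2.2 b = -P.km (P.actm b x) y := rfl

theorem kp_anti : P.kp x z = -P.kp z x := by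
  have h := P.plus.k_self (x + z)
  simp only [map_add, LinearMap.add_apply, P.plus.k_self, zero_add, add_zero] at h
  exact eq_neg_of_add_eq_zero_right h

theorem km_anti : P.km y w = -P.km w y := P.op.kp_anti y w
theorem Dp_comm : P.Dp a b c = P.Dp c b a := qTriple_comm _ _ _ _
theorem Dm_comm : P.Dm b a d = P.Dm d a b := qTriple_comm _ _ _ _

/-- the identity `b ∘ (κ(x, z) ∘ y) = {b ∘ x, z, y} - {b ∘ z, x, y}` -/
theorem act_k_act : P.actm b (P.actp (P.kp x z) y) =
    P.Vm (P.actm b x) z y - P.Vm (P.actm b z) x y := by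
  have h1 := P.plus.k_act_left b x y z
  have h2 := P.plus.k_act_left b z y x
  have h3 := P.minus.k_act (P.actm b x) y z
  have h4 := P.minus.k_act (P.actm b z) y x
  simp only [JordanKantorData.op] at h3 h4
  rw [P.plus.k_act, map_sub]
  linear_combination (norm := module) h3 - h1 + h2 - h4
end

/-- Derivation rules for `T` on the products with values in `J⁺` and `M⁺`. -/
structure IsHalfDer (P : JordanKantorPair k Jp Jm Mp Mm) (T : BlockEnd k Jp Mp Mm Jm) : Prop where
  D : ∀ a b c, T.1 (P.Dp a b c) = P.Dp (T.1 a) b c + P.Dp a (T.2.2.2 b) c + P.Dp a b (T.1 c)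
  V : ∀ x y z, T.2.1 (P.Vp x y z) =
    P.Vp (T.2.1 x) y z + P.Vp x (T.2.2.1 y) z + P.Vp x y (T.2.1 z)
  act : ∀ a y, T.2.1 (P.actp a y) = P.actp (T.1 a) y + P.actp a (T.2.2.1 y)
  k : ∀ x z, T.1 (P.kp x z) = P.kp (T.2.1 x) z + P.kp x (T.2.1 z)

/-- A block endomorphism seen as a block endomorphism of the opposite pair. -/
def swap (T : BlockEnd k Jp Mp Mm Jm) : BlockEnd k Jm Mm Mp Jp := (T.2.2.2, T.2.2.1, T.2.1, T.1)

/-- `T` is a derivation of `P`. -/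
def IsDer (T : BlockEnd k Jp Mp Mm Jm) : Prop := P.IsHalfDer T ∧ P.op.IsHalfDer (swap T)

theorem IsHalfDer.neg {T : BlockEnd k Jp Mp Mm Jm} (h : P.IsHalfDer T) : P.IsHalfDer (-T) where
  D a b c := by simp [h.D]; abel
  V a b c := by simp [h.V]; abel
  act a b := by simp [h.act]; abel
  k a b := by simp [h.k]; abel

theorem isHalfDer_delta (a b) : P.IsHalfDer (P.delta a b) where
  D c d e := by
    have := P.jordan.five_linear a c e b d
    simp only [delta_2, delta_m2, map_neg, LinearMap.neg_apply]
    linear_combination (norm := module) this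
  V x y z := by
    simp only [delta_1, delta_m1, map_neg, LinearMap.neg_apply]
    have h1 := congrArg (P.actp a) (P.plus.k_act_left b x y z)
    have h2 := P.minus.k_act_left a y x (P.actm b z)
    have h3 := P.op.act_k_act a (P.actm b x) y z
    have h4 := P.plus.k_act_act (P.actp a y) x b z
    simp only [op, JordanKantorData.op, map_add] at h1 h2 h3
    linear_combination (norm := module) -h1 + h3 + h2 - h4
  act c y := by
    simp only [delta_2, delta_1, delta_m1, map_neg, P.plus.special]
    abel
  k x z := by
    simp only [delta_2, delta_1]
    rw [Dp_comm, P.plus.D_k_left]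

theorem isHalfDer_upsilon (x y) : P.IsHalfDer (P.upsilon x y) where
  D a b c := by
    simp only [upsilon_2, upsilon_m2, map_neg, LinearMap.neg_apply, P.plus.special, map_add]
    rw [P.Dp_comm a (P.kp (P.actp c y) x) b, P.plus.D_k_left, P.plus.D_k_left, P.plus.D_k_mid,
      LinearMap.add_apply]
    abel
  V z w u := by
    simp only [upsilon_1, upsilon_m1, map_neg, LinearMap.neg_apply]
    linear_combination (norm := module) P.plus.V_V x y z w u
  act c w := by
    simp only [upsilon_2, upsilon_1, upsilon_m1, map_neg]
    have := P.minus.k_act_left c y x w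
    simp only [JordanKantorData.op] at this
    rw [this]; abel
  k z u := by
    simp only [upsilon_2, upsilon_1]
    exact P.plus.k_k z u y x

theorem isDer_delta (a b) : P.IsDer (P.delta a b) := by
  refine ⟨P.isHalfDer_delta a b, ?_⟩
  have := (P.op.isHalfDer_delta b a).neg
  convert this using 1
  simp only [swap, delta, LinearMap.mk₂_apply, op, JordanKantorData.op, Prod.neg_mk, neg_neg]

theorem isDer_upsilon (x y) : P.IsDer (P.upsilon x y) := by
  refine ⟨P.isHalfDer_upsilon x y, ?_⟩
  have := (P.op.isHalfDer_upsilon y x).neg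
  convert this using 1
  simp only [swap, upsilon, LinearMap.mk₂_apply, op, JordanKantorData.op, Prod.neg_mk, neg_neg]

theorem IsHalfDer.add {T S : BlockEnd k Jp Mp Mm Jm} (h : P.IsHalfDer T) (h' : P.IsHalfDer S) :
    P.IsHalfDer (T + S) where
  D a b c := by simp [h.D, h'.D]; abel
  V a b c := by simp [h.V, h'.V]; abel
  act a b := by simp [h.act, h'.act]; abel
  k a b := by simp [h.k, h'.k]; abel

theorem IsHalfDer.smul {T : BlockEnd k Jp Mp Mm Jm} (h : P.IsHalfDer T) (r : k) :
    P.IsHalfDer (r • T) where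
  D a b c := by simp [h.D]
  V a b c := by simp [h.V]
  act a b := by simp [h.act]
  k a b := by simp [h.k]

theorem isHalfDer_zero : P.IsHalfDer 0 where
  D a b c := by simp
  V a b c := by simp
  act a b := by simp
  k a b := by simp

variable {P}

theorem IsDer.lie_delta {T : BlockEnd k Jp Mp Mm Jm} (h : P.IsDer T) (a b) :
    ⁅T, P.delta a b⁆ = P.delta (T.1 a) b + P.delta a (T.2.2.2 b) := by
  have h1 := h.1.D; have h2 := h.2.D; have h3 := h.1.act; have h4 := h.2.act
  simp only [op, JordanKantorData.op, JordanKantorData.Dp, swap] at h1 h2 h3 h4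
  refine Prod.ext (LinearMap.ext fun c => ?_) (Prod.ext (LinearMap.ext fun c => ?_)
    (Prod.ext (LinearMap.ext fun c => ?_) (LinearMap.ext fun c => ?_)))
  all_goals
    simp [LieRing.of_associative_ring_bracket, h1, h2, h3, h4]
    try abel

theorem IsDer.lie_upsilon {T : BlockEnd k Jp Mp Mm Jm} (h : P.IsDer T) (x y) :
    ⁅T, P.upsilon x y⁆ = P.upsilon (T.2.1 x) y + P.upsilon x (T.2.2.1 y) := by
  have h1 := h.1.V; have h2 := h.2.V; have h3 := h.1.act; have h4 := h.2.act
  have h5 := h.1.k; have h6 := h.2.k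
  simp only [op, JordanKantorData.op, swap] at h1 h2 h3 h4 h5 h6
  refine Prod.ext (LinearMap.ext fun c => ?_) (Prod.ext (LinearMap.ext fun c => ?_)
    (Prod.ext (LinearMap.ext fun c => ?_) (LinearMap.ext fun c => ?_)))
  all_goals
    simp [LieRing.of_associative_ring_bracket, h1, h2, h3, h4, h5, h6]
    try abel

variable (P)

/-- The operators `δ(a, b)` and `v(x, y)`. -/
def innerSet : Set (BlockEnd k Jp Mp Mm Jm) :=
  {T | ∃ a b, T = P.delta a b} ∪ {T | ∃ x y, T = P.upsilon x y}

theorem isDer_of_mem_span {T} (hT : T ∈ Submodule.span k P.innerSet) : P.IsDer T := by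
  induction hT using Submodule.span_induction with
  | mem T hT =>
    rcases hT with ⟨a, b, rfl⟩ | ⟨a, b, rfl⟩
    · exact P.isDer_delta a b
    · exact P.isDer_upsilon a b
  | zero => exact ⟨P.isHalfDer_zero, P.op.isHalfDer_zero⟩
  | add T S _ _ h h' => exact ⟨h.1.add _ h'.1, h.2.add _ h'.2⟩
  | smul r T _ h => exact ⟨h.1.smul _ r, h.2.smul _ r⟩

/-- The inner derivation algebra: the span of all `δ(a, b)` and `v(x, y)`. -/
noncomputable def instr : LieSubalgebra k (BlockEnd k Jp Mp Mm Jm) where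
  __ := Submodule.span k P.innerSet
  lie_mem' := by
    intro T S hT hS
    have hd := P.isDer_of_mem_span hT
    change S ∈ Submodule.span k P.innerSet at hS
    change ⁅T, S⁆ ∈ Submodule.span k P.innerSet
    induction hS using Submodule.span_induction with
    | mem S hS =>
      rcases hS with ⟨a, b, rfl⟩ | ⟨a, b, rfl⟩
      · rw [hd.lie_delta]
        exact add_mem (Submodule.subset_span (Or.inl ⟨_, _, rfl⟩))
          (Submodule.subset_span (Or.inl ⟨_, _, rfl⟩))
      · rw [hd.lie_upsilon]
        exact add_mem (Submodule.subset_span (Or.inr ⟨_, _, rfl⟩))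
          (Submodule.subset_span (Or.inr ⟨_, _, rfl⟩))
    | zero => rw [lie_zero]; exact zero_mem _
    | add S S' _ _ h h' => rw [lie_add]; exact add_mem h h'
    | smul r S _ h => rw [lie_smul]; exact Submodule.smul_mem _ r h

theorem delta_mem (a b) : P.delta a b ∈ P.instr := Submodule.subset_span (Or.inl ⟨a, b, rfl⟩)
theorem upsilon_mem (x y) : P.upsilon x y ∈ P.instr := Submodule.subset_span (Or.inr ⟨x, y, rfl⟩)
theorem isDer_coe (T : P.instr) : P.IsDer (T : BlockEnd k Jp Mp Mm Jm) := P.isDer_of_mem_span T.2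

theorem delta_k (u x b) : P.delta (P.kp u x) b =
    P.upsilon x (P.actm b u) - P.upsilon u (P.actm b x) := by
  refine Prod.ext (LinearMap.ext fun c => ?_) (Prod.ext (LinearMap.ext fun c => ?_)
    (Prod.ext (LinearMap.ext fun c => ?_) (LinearMap.ext fun c => ?_)))
  · simp only [Prod.fst_sub, LinearMap.sub_apply, delta_2, upsilon_2]
    rw [P.plus.D_k_left, P.kp_anti u]; abel
  · simp only [Prod.fst_sub, Prod.snd_sub, LinearMap.sub_apply, delta_1, upsilon_1]
    rw [P.plus.k_act_act]
  · simp only [Prod.fst_sub, Prod.snd_sub, LinearMap.sub_apply, delta_m1, upsilon_m1]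
    rw [P.act_k_act]; abel
  · simp only [Prod.snd_sub, LinearMap.sub_apply, delta_m2, upsilon_m2]
    have := P.minus.D_k_mid b c u x
    simp only [JordanKantorData.op, JordanKantorData.Dp] at this
    rw [this, P.km_anti (P.actm b x)]; abel

theorem delta_k' (a y w) : P.delta a (P.km y w) =
    P.upsilon (P.actp a y) w - P.upsilon (P.actp a w) y := by
  have h := congrArg (fun T => swap (-T)) (P.op.delta_k y w a)
  refine (show P.delta a (P.km y w) = _ from ?_).trans (h.trans ?_)
  · simp only [swap, delta, LinearMap.mk₂_apply, op, JordanKantorData.op, Prod.neg_mk, neg_neg]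
  · simp only [swap, upsilon, LinearMap.mk₂_apply, op, JordanKantorData.op, Prod.neg_mk,
      Prod.mk_sub_mk, neg_sub, sub_neg_eq_add]
    refine Prod.ext ?_ (Prod.ext ?_ (Prod.ext ?_ ?_)) <;> dsimp only <;> abel

/-- `(J⁺ ⊗ J⁻) ⊕ (M⁺ ⊗ M⁻)` -/
abbrev PreUider (_P : JordanKantorPair k Jp Jm Mp Mm) : Type _ := (Jp ⊗[k] Jm) × (Mp ⊗[k] Mm)

/-- The submodule `I(P)` of relations. -/
def uiderRel : Submodule k P.PreUider :=
  Submodule.span k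
    ({t | ∃ x y, t = (0, x ⊗ₜ P.Vm y x y - P.Vp x y x ⊗ₜ y)} ∪
     {t | ∃ x y u w, t = (0, P.Vp x y u ⊗ₜ w + P.Vp u w x ⊗ₜ y - u ⊗ₜ P.Vm y x w
        - x ⊗ₜ P.Vm w u y)} ∪
     {t | ∃ a b, t = (a ⊗ₜ P.Dm b a b - P.Dp a b a ⊗ₜ b, 0)} ∪
     {t | ∃ a b c d, t = (P.Dp a b c ⊗ₜ d - c ⊗ₜ P.Dm b a d + P.Dp c d a ⊗ₜ b
        - a ⊗ₜ P.Dm b c d, 0)} ∪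
     {t | ∃ u x b, t = (P.kp u x ⊗ₜ b, -(x ⊗ₜ P.actm b u) + u ⊗ₜ P.actm b x)} ∪
     {t | ∃ a y w, t = (a ⊗ₜ P.km y w, -(P.actp a y ⊗ₜ w) + P.actp a w ⊗ₜ y)})

/-- The universal derivation algebra `uider(P)`, as a module; its Lie bracket is defined below. -/
def Uider : Type _ := P.PreUider ⧸ P.uiderRel

noncomputable instance : AddCommGroup P.Uider := inferInstanceAs (AddCommGroup (_ ⧸ P.uiderRel))
noncomputable instance : Module k P.Uider := inferInstanceAs (Module k (_ ⧸ P.uiderRel))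

/-- The quotient map onto `uider(P)`. -/
noncomputable def uiderMk : P.PreUider →ₗ[k] P.Uider := P.uiderRel.mkQ

/-- `a ⋄ b` for `(a, b)` in `J`. -/
noncomputable def diaJ : Jp →ₗ[k] Jm →ₗ[k] P.Uider :=
  (TensorProduct.mk k Jp Jm).compr₂ (P.uiderMk ∘ₗ LinearMap.inl k _ _)

/-- `x ⋄ y` for `(x, y)` in `M`. -/
noncomputable def diaM : Mp →ₗ[k] Mm →ₗ[k] P.Uider :=
  (TensorProduct.mk k Mp Mm).compr₂ (P.uiderMk ∘ₗ LinearMap.inr k _ _)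

theorem uiderMk_eq_zero {t} : t ∈ P.uiderRel → P.uiderMk t = 0 :=
  (Submodule.Quotient.mk_eq_zero _).2

theorem mk_inl (a b) : P.uiderMk (a ⊗ₜ b, 0) = P.diaJ a b := rfl
theorem mk_inr (a b) : P.uiderMk (0, a ⊗ₜ b) = P.diaM a b := rfl

theorem mk_mk (s t) : P.uiderMk (s, t) =
    P.uiderMk (LinearMap.inl k _ _ s) + P.uiderMk (LinearMap.inr k _ _ t) := by
  rw [← map_add]; simp

/-- A pair of bilinear maps that respects the relations of `uider(P)`. -/
structure Balanced {N : Type*} [AddCommGroup N] [Module k N] (f : Jp →ₗ[k] Jm →ₗ[k] N)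
    (g : Mp →ₗ[k] Mm →ₗ[k] N) : Prop where
  r1 : ∀ x y, g x (P.Vm y x y) = g (P.Vp x y x) y
  r2 : ∀ x y u w, g (P.Vp x y u) w + g (P.Vp u w x) y = g u (P.Vm y x w) + g x (P.Vm w u y)
  r3 : ∀ a b, f a (P.Dm b a b) = f (P.Dp a b a) b
  r4 : ∀ a b c d, f (P.Dp a b c) d + f (P.Dp c d a) b = f c (P.Dm b a d) + f a (P.Dm b c d)
  r5 : ∀ u x b, f (P.kp u x) b = g x (P.actm b u) - g u (P.actm b x)
  r6 : ∀ a y w, f a (P.km y w) = g (P.actp a y) w - g (P.actp a w) y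

theorem balanced_dia : P.Balanced P.diaJ P.diaM where
  r1 x y := by
    have h := P.uiderMk_eq_zero (Submodule.subset_span
      (Or.inl <| Or.inl <| Or.inl <| Or.inl <| Or.inl ⟨x, y, rfl⟩))
    rw [mk_mk] at h
    simp only [map_sub, map_zero, LinearMap.inr_apply, mk_inr] at h
    linear_combination (norm := module) h
  r2 x y u w := by
    have h := P.uiderMk_eq_zero (Submodule.subset_span
      (Or.inl <| Or.inl <| Or.inl <| Or.inl <| Or.inr ⟨x, y, u, w, rfl⟩))
    rw [mk_mk] at h
    simp only [map_add, map_sub, map_zero, LinearMap.inr_apply, mk_inr] at h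
    linear_combination (norm := module) h
  r3 x y := by
    have h := P.uiderMk_eq_zero (Submodule.subset_span
      (Or.inl <| Or.inl <| Or.inl <| Or.inr ⟨x, y, rfl⟩))
    rw [mk_mk] at h
    simp only [map_sub, map_zero, LinearMap.inl_apply, mk_inl] at h
    linear_combination (norm := module) h
  r4 x y u w := by
    have h := P.uiderMk_eq_zero (Submodule.subset_span
      (Or.inl <| Or.inl <| Or.inr ⟨x, y, u, w, rfl⟩))
    rw [mk_mk] at h
    simp only [map_add, map_sub, map_zero, LinearMap.inl_apply, mk_inl] at h
    linear_combination (norm := module) h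
  r5 x y u := by
    have h := P.uiderMk_eq_zero (Submodule.subset_span (Or.inl <| Or.inr ⟨x, y, u, rfl⟩))
    rw [mk_mk] at h
    simp only [map_add, map_neg, LinearMap.inl_apply, LinearMap.inr_apply, mk_inl, mk_inr] at h
    linear_combination (norm := module) h
  r6 x y u := by
    have h := P.uiderMk_eq_zero (Submodule.subset_span (Or.inr ⟨x, y, u, rfl⟩))
    rw [mk_mk] at h
    simp only [map_add, map_neg, LinearMap.inl_apply, LinearMap.inr_apply, mk_inl, mk_inr] at h
    linear_combination (norm := module) h

section lift
variable {N : Type*} [AddCommGroup N] [Module k N] {f : Jp →ₗ[k] Jm →ₗ[k] N}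
  {g : Mp →ₗ[k] Mm →ₗ[k] N}

variable {P} in
/-- The linear map on `uider(P)` with `a ⋄ b ↦ f a b` and `x ⋄ y ↦ g x y`. -/
noncomputable def Balanced.lift (h : P.Balanced f g) : P.Uider →ₗ[k] N :=
  P.uiderRel.liftQ ((TensorProduct.lift f).coprod (TensorProduct.lift g)) (by
    rw [uiderRel, Submodule.span_le]
    rintro t (((((⟨x, y, rfl⟩ | ⟨x, y, u, w, rfl⟩) | ⟨a, b, rfl⟩) | ⟨a, b, c, d, rfl⟩) |
      ⟨u, x, b, rfl⟩) | ⟨a, y, w, rfl⟩)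
    · simp [h.r1]
    · have := h.r2 x y u w
      simp only [SetLike.mem_coe, LinearMap.mem_ker, LinearMap.coprod_apply, map_zero, map_sub,
        map_add, TensorProduct.lift.tmul]
      linear_combination (norm := module) this
    · simp [h.r3]
    · have := h.r4 a b c d
      simp only [SetLike.mem_coe, LinearMap.mem_ker, LinearMap.coprod_apply, map_zero, map_sub,
        map_add, TensorProduct.lift.tmul]
      linear_combination (norm := module) this
    · simp [h.r5]
    · simp [h.r6])

variable {P}
@[simp] theorem Balanced.lift_diaJ (h : P.Balanced f g) (a b) : h.lift (P.diaJ a b) = f a b := by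
  change P.uiderRel.liftQ _ _ (P.uiderRel.mkQ (a ⊗ₜ b, 0)) = _
  simp

@[simp] theorem Balanced.lift_diaM (h : P.Balanced f g) (a b) : h.lift (P.diaM a b) = g a b := by
  change P.uiderRel.liftQ _ _ (P.uiderRel.mkQ (0, a ⊗ₜ b)) = _
  simp
end lift

variable {P} in
theorem uider_induction {motive : P.Uider → Prop} (hJ : ∀ a b, motive (P.diaJ a b))
    (hM : ∀ x y, motive (P.diaM x y)) (h0 : motive 0)
    (hadd : ∀ p q, motive p → motive q → motive (p + q)) (p : P.Uider) : motive p := by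
  obtain ⟨⟨s, t⟩, rfl⟩ := P.uiderRel.mkQ_surjective p
  change motive (P.uiderMk (s, t))
  rw [mk_mk]
  refine hadd _ _ ?_ ?_
  · induction s with
    | zero => rw [map_zero, map_zero]; exact h0
    | tmul a b => exact hJ a b
    | add s s' h h' => rw [map_add, map_add]; exact hadd _ _ h h'
  · induction t with
    | zero => rw [map_zero, map_zero]; exact h0
    | tmul a b => exact hM a b
    | add s s' h h' => rw [map_add, map_add]; exact hadd _ _ h h'

theorem balanced_inner : P.Balanced P.delta P.upsilon where
  r1 x y := by
    have h := (P.isDer_upsilon x y).lie_upsilon x y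
    rw [lie_self] at h
    simp only [upsilon_1, upsilon_m1, map_neg] at h
    linear_combination (norm := module) h
  r2 x y u w := by
    have h := (P.isDer_upsilon x y).lie_upsilon u w
    have h' := (P.isDer_upsilon u w).lie_upsilon x y
    rw [← lie_skew, h'] at h
    simp only [upsilon_1, upsilon_m1, map_neg] at h
    linear_combination (norm := module) -h
  r3 x y := by
    have h := (P.isDer_delta x y).lie_delta x y
    rw [lie_self] at h
    simp only [delta_2, delta_m2, map_neg] at h
    linear_combination (norm := module) h
  r4 x y u w := by
    have h := (P.isDer_delta x y).lie_delta u w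
    have h' := (P.isDer_delta u w).lie_delta x y
    rw [← lie_skew, h'] at h
    simp only [delta_2, delta_m2, map_neg] at h
    rw [P.Dm_comm u y w]
    linear_combination (norm := module) -h
  r5 u x b := P.delta_k u x b
  r6 a y w := P.delta_k' a y w

/-- The linear map `a ⋄ b ↦ δ(a, b)`, `x ⋄ y ↦ v(x, y)`. -/
noncomputable def udEnd : P.Uider →ₗ[k] BlockEnd k Jp Mp Mm Jm := P.balanced_inner.lift

theorem udEnd_mem (p : P.Uider) : P.udEnd p ∈ P.instr := by
  induction p using uider_induction with
  | hJ a b => rw [udEnd, Balanced.lift_diaJ]; exact P.delta_mem a b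
  | hM a b => rw [udEnd, Balanced.lift_diaM]; exact P.upsilon_mem a b
  | h0 => rw [map_zero]; exact zero_mem _
  | hadd p q hp hq => rw [map_add]; exact add_mem hp hq

/-- The same map with values in the inner derivation algebra. -/
noncomputable def udLin : P.Uider →ₗ[k] P.instr :=
  LinearMap.codRestrict P.instr.toSubmodule P.udEnd P.udEnd_mem

@[simp] theorem coe_udLin_diaJ (a b) :
    (P.udLin (P.diaJ a b) : BlockEnd k Jp Mp Mm Jm) = P.delta a b :=
  P.balanced_inner.lift_diaJ a b
@[simp] theorem coe_udLin_diaM (a b) :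
    (P.udLin (P.diaM a b) : BlockEnd k Jp Mp Mm Jm) = P.upsilon a b :=
  P.balanced_inner.lift_diaM a b

variable {P}

theorem IsDer.balanced {T : BlockEnd k Jp Mp Mm Jm} (h : P.IsDer T) :
    P.Balanced (P.diaJ ∘ₗ T.1 + P.diaJ.compl₂ T.2.2.2)
      (P.diaM ∘ₗ T.2.1 + P.diaM.compl₂ T.2.2.1) := by
  have B := P.balanced_dia
  have hD := h.1.D; have hD' := h.2.D; have hV := h.1.V; have hV' := h.2.V
  have ha := h.1.act; have ha' := h.2.act; have hk := h.1.k; have hk' := h.2.k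
  simp only [op, JordanKantorData.op, JordanKantorData.Dp, swap] at hD' hV' ha' hk'
  constructor
  · intro x y
    have h1 := B.r2 (T.2.1 x) y x y
    have h2 := B.r2 x (T.2.2.1 y) x y
    simp only [LinearMap.add_apply, LinearMap.comp_apply, LinearMap.compl₂_apply, hV, hV', map_add]
    linear_combination (norm := module) -h1 - h2
  · intro x y u w
    have h1 := B.r2 (T.2.1 x) y u w
    have h2 := B.r2 x (T.2.2.1 y) u w
    have h3 := B.r2 x y (T.2.1 u) w
    have h4 := B.r2 x y u (T.2.2.1 w)
    simp only [LinearMap.add_apply, LinearMap.comp_apply, LinearMap.compl₂_apply, hV, hV', map_add]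
    linear_combination (norm := module) h1 + h2 + h3 + h4
  · intro x y
    have h1 := B.r4 (T.1 x) y x y
    have h2 := B.r4 x (T.2.2.2 y) x y
    have e := P.Dm_comm x (T.2.2.2 y) y
    simp only [LinearMap.add_apply, LinearMap.comp_apply, LinearMap.compl₂_apply, hD, hD', map_add]
    rw [e] at h2 ⊢
    linear_combination (norm := module) -h1 - h2
  · intro x y u w
    have h1 := B.r4 (T.1 x) y u w
    have h2 := B.r4 x (T.2.2.2 y) u w
    have h3 := B.r4 x y (T.1 u) w
    have h4 := B.r4 x y u (T.2.2.2 w)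
    simp only [LinearMap.add_apply, LinearMap.comp_apply, LinearMap.compl₂_apply, hD, hD', map_add]
    linear_combination (norm := module) h1 + h2 + h3 + h4
  · intro u x b
    simp only [LinearMap.add_apply, LinearMap.comp_apply, LinearMap.compl₂_apply, hk, ha', map_add,
      B.r5]
    abel
  · intro a y w
    simp only [LinearMap.add_apply, LinearMap.comp_apply, LinearMap.compl₂_apply, hk', ha, map_add,
      B.r6]
    abel

variable (P)

/-- The action `T.(a ⋄ b) = T.a ⋄ b + a ⋄ T.b`, `T.(x ⋄ y) = T.x ⋄ y + x ⋄ T.y` of the inner derivation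
algebra on `uider(P)`. -/
noncomputable def actU : P.instr →ₗ[k] Module.End k P.Uider where
  toFun T := (P.isDer_coe T).balanced.lift
  map_add' T S := by
    ext p
    induction p using uider_induction with
    | hJ a b => simp; abel
    | hM a b => simp; abel
    | h0 => simp only [map_zero]
    | hadd p q hp hq => simp only [map_add, hp, hq]
  map_smul' r T := by
    ext p
    induction p using uider_induction with
    | hJ a b => simp
    | hM a b => simp
    | h0 => simp only [map_zero]
    | hadd p q hp hq => simp only [map_add, hp, hq]

@[simp] theorem actU_diaJ (T : P.instr) (a b) :
    P.actU T (P.diaJ a b) = P.diaJ (T.1.1 a) b + P.diaJ a (T.1.2.2.2 b) :=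
  (P.isDer_coe T).balanced.lift_diaJ a b

@[simp] theorem actU_diaM (T : P.instr) (x y) :
    P.actU T (P.diaM x y) = P.diaM (T.1.2.1 x) y + P.diaM x (T.1.2.2.1 y) :=
  (P.isDer_coe T).balanced.lift_diaM x y

theorem actU_lie (T S : P.instr) (p : P.Uider) :
    P.actU ⁅T, S⁆ p = P.actU T (P.actU S p) - P.actU S (P.actU T p) := by
  induction p using uider_induction with
  | hJ a b =>
    simp [LieRing.of_associative_ring_bracket]; abel
  | hM a b =>
    simp [LieRing.of_associative_ring_bracket]; abel
  | h0 => simp only [map_zero, sub_zero]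
  | hadd p q hp hq => simp only [map_add, hp, hq]; abel

theorem udLin_actU (T : P.instr) (p : P.Uider) : P.udLin (P.actU T p) = ⁅T, P.udLin p⁆ := by
  induction p using uider_induction with
  | hJ a b =>
    apply Subtype.ext
    rw [actU_diaJ, map_add, LieSubalgebra.coe_bracket, coe_udLin_diaJ, (P.isDer_coe T).lie_delta]
    simp
  | hM a b =>
    apply Subtype.ext
    rw [actU_diaM, map_add, LieSubalgebra.coe_bracket, coe_udLin_diaM, (P.isDer_coe T).lie_upsilon]
    simp
  | h0 => simp only [map_zero, lie_zero]
  | hadd p q hp hq => simp only [map_add, hp, hq, lie_add]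

theorem actU_skew (p q : P.Uider) : P.actU (P.udLin p) q + P.actU (P.udLin q) p = 0 := by
  have B := P.balanced_dia
  have mixed : ∀ a b x y, P.actU (P.udLin (P.diaJ a b)) (P.diaM x y) +
      P.actU (P.udLin (P.diaM x y)) (P.diaJ a b) = 0 := fun a b x y => by
    simp [B.r5, B.r6]
    abel
  induction p using uider_induction with
  | hJ a b =>
    induction q using uider_induction with
    | hJ c d =>
      have := B.r4 a b c d
      have e := P.Dm_comm c b d
      simp only [actU_diaJ, coe_udLin_diaJ, delta_2, delta_m2, map_neg]
      rw [← e]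
      linear_combination (norm := module) this
    | hM x y => exact mixed a b x y
    | h0 => simp
    | hadd p q hp hq =>
      rw [← add_zero (0 : P.Uider)]; nth_rewrite 1 [← hp]; rw [← hq]
      simp only [map_add, LinearMap.add_apply]; abel
  | hM a b =>
    induction q using uider_induction with
    | hM c d =>
      have := B.r2 a b c d
      simp only [actU_diaM, coe_udLin_diaM, upsilon_1, upsilon_m1, map_neg]
      linear_combination (norm := module) this
    | hJ x y => rw [add_comm]; exact mixed x y a b
    | h0 => simp
    | hadd p q hp hq =>
      rw [← add_zero (0 : P.Uider)]; nth_rewrite 1 [← hp]; rw [← hq]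
      simp only [map_add, LinearMap.add_apply]; abel
  | h0 => simp
  | hadd p q hp hq =>
    rw [← add_zero (0 : P.Uider)]; nth_rewrite 1 [← hp]; rw [← hq]
    simp only [map_add, LinearMap.add_apply]; abel

theorem actU_self (p : P.Uider) : P.actU (P.udLin p) p = 0 := by
  have B := P.balanced_dia
  induction p using uider_induction with
  | hJ a b => simp [B.r3]
  | hM a b => simp [B.r1]
  | h0 => simp
  | hadd p q hp hq =>
    have := P.actU_skew p q
    simp only [map_add, LinearMap.add_apply, hp, hq]
    linear_combination (norm := module) this

/-- The Lie bracket `[p, q] = ud(p).q` of `uider(P)`. -/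
noncomputable instance : LieRing P.Uider where
  bracket p q := P.actU (P.udLin p) q
  add_lie p q r := by
    change P.actU _ _ = P.actU _ _ + P.actU _ _
    rw [map_add, map_add, LinearMap.add_apply]
  lie_add p q r := map_add _ _ _
  lie_self := P.actU_self
  leibniz_lie p q r := by
    change P.actU _ (P.actU _ _) = P.actU (P.udLin (P.actU _ _)) _ + P.actU _ (P.actU _ _)
    rw [udLin_actU, actU_lie]; abel

noncomputable instance : LieAlgebra k P.Uider where
  lie_smul r p q := map_smul (P.actU (P.udLin p)) r q

/-- The homomorphism `ud : uider(P) → instr(P)`, `a ⋄ b ↦ δ(a, b)`, `x ⋄ y ↦ v(x, y)`. -/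
noncomputable def ud : P.Uider →ₗ⁅k⁆ P.instr where
  __ := P.udLin
  map_lie' {p q} := P.udLin_actU (P.udLin p) q

/-- The cyclic homology `HC(P)`: all `∑ aᵢ ⋄ bᵢ + ∑ xⱼ ⋄ yⱼ` with `∑ δ(aᵢ, bᵢ) + ∑ v(xⱼ, yⱼ) = 0`, that is
the kernel of `ud`. -/
noncomputable def HC : LieIdeal k P.Uider := P.ud.ker

/-- The module `TKK(P) = J⁺ ⊕ M⁺ ⊕ instr(P) ⊕ M⁻ ⊕ J⁻`, in the degrees `2, 1, 0, -1, -2`. -/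
def TKK : Type _ := Jp × Mp × P.instr × Mm × Jm

noncomputable instance : AddCommGroup P.TKK := inferInstanceAs (AddCommGroup (_ × _))
noncomputable instance : Module k P.TKK := inferInstanceAs (Module k (_ × _))

variable {P}

theorem tkk_ext {p q : P.TKK} (h1 : p.1 = q.1) (h2 : p.2.1 = q.2.1)
    (h3 : (p.2.2.1 : BlockEnd k Jp Mp Mm Jm) = q.2.2.1)
    (h4 : p.2.2.2.1 = q.2.2.2.1) (h5 : p.2.2.2.2 = q.2.2.2.2) : p = q :=
  Prod.ext h1 (Prod.ext h2 (Prod.ext (Subtype.ext h3) (Prod.ext h4 h5)))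

/-- The product of the Tits-Kantor-Koecher algebra: `[a, y] = a ∘ y`, `[a, b] = δ(a, b)`,
`[x, y] = v(x, y)`, `[b, x] = b ∘ x`, `[x, u] = κ(x, u)`, `[y, w] = κ(y, w)`, `[T, p] = T.p`, extended
bilinearly and antisymmetrically. -/
noncomputable instance : Bracket P.TKK P.TKK where
  bracket
    | (a, x, T, y, b), (c, u, S, w, d) =>
      (T.1.1 c - S.1.1 a + P.kp x u,
       T.1.2.1 u - S.1.2.1 x + P.actp a w - P.actp c y,
       ⁅T, S⁆ + ⟨P.delta a d, P.delta_mem a d⟩ + ⟨P.upsilon x w, P.upsilon_mem x w⟩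
         - ⟨P.delta c b, P.delta_mem c b⟩ - ⟨P.upsilon u y, P.upsilon_mem u y⟩,
       T.1.2.2.1 w - S.1.2.2.1 y + P.actm b u - P.actm d x,
       T.1.2.2.2 d - S.1.2.2.2 b + P.km y w)

section
variable (p q : P.TKK)
theorem tkk_lie_2 : ⁅p, q⁆.1 = p.2.2.1.1.1 q.1 - q.2.2.1.1.1 p.1 + P.kp p.2.1 q.2.1 := rfl
theorem tkk_lie_1 : ⁅p, q⁆.2.1 = p.2.2.1.1.2.1 q.2.1 - q.2.2.1.1.2.1 p.2.1
    + P.actp p.1 q.2.2.2.1 - P.actp q.1 p.2.2.2.1 := rfl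
theorem tkk_lie_0 : (⁅p, q⁆.2.2.1 : BlockEnd k Jp Mp Mm Jm) =
    ⁅(p.2.2.1 : BlockEnd k Jp Mp Mm Jm), (q.2.2.1 : BlockEnd k Jp Mp Mm Jm)⁆
    + P.delta p.1 q.2.2.2.2 + P.upsilon p.2.1 q.2.2.2.1 - P.delta q.1 p.2.2.2.2
    - P.upsilon q.2.1 p.2.2.2.1 := rfl
theorem tkk_lie_m1 : ⁅p, q⁆.2.2.2.1 = p.2.2.1.1.2.2.1 q.2.2.2.1 - q.2.2.1.1.2.2.1 p.2.2.2.1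
    + P.actm p.2.2.2.2 q.2.1 - P.actm q.2.2.2.2 p.2.1 := rfl
theorem tkk_lie_m2 : ⁅p, q⁆.2.2.2.2 = p.2.2.1.1.2.2.2 q.2.2.2.2 - q.2.2.1.1.2.2.2 p.2.2.2.2
    + P.km p.2.2.2.1 q.2.2.2.1 := rfl
theorem tkk_add_2 : (p + q).1 = p.1 + q.1 := rfl
theorem tkk_add_1 : (p + q).2.1 = p.2.1 + q.2.1 := rfl
theorem tkk_add_0 : ((p + q).2.2.1 : BlockEnd k Jp Mp Mm Jm) =
    (p.2.2.1 : BlockEnd k Jp Mp Mm Jm) + q.2.2.1 := rfl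
theorem tkk_add_m1 : (p + q).2.2.2.1 = p.2.2.2.1 + q.2.2.2.1 := rfl
theorem tkk_add_m2 : (p + q).2.2.2.2 = p.2.2.2.2 + q.2.2.2.2 := rfl
theorem tkk_smul_2 (r : k) : (r • p).1 = r • p.1 := rfl
theorem tkk_smul_1 (r : k) : (r • p).2.1 = r • p.2.1 := rfl
theorem tkk_smul_0 (r : k) : ((r • p).2.2.1 : BlockEnd k Jp Mp Mm Jm) =
    r • (p.2.2.1 : BlockEnd k Jp Mp Mm Jm) := rfl
theorem tkk_smul_m1 (r : k) : (r • p).2.2.2.1 = r • p.2.2.2.1 := rfl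
theorem tkk_smul_m2 (r : k) : (r • p).2.2.2.2 = r • p.2.2.2.2 := rfl
end

theorem blockEnd_lie_2 (T S : BlockEnd k Jp Mp Mm Jm) (a : Jp) :
    ⁅T, S⁆.1 a = T.1 (S.1 a) - S.1 (T.1 a) := rfl
theorem blockEnd_lie_1 (T S : BlockEnd k Jp Mp Mm Jm) (a : Mp) :
    ⁅T, S⁆.2.1 a = T.2.1 (S.2.1 a) - S.2.1 (T.2.1 a) := rfl
theorem blockEnd_lie_m1 (T S : BlockEnd k Jp Mp Mm Jm) (a : Mm) :
    ⁅T, S⁆.2.2.1 a = T.2.2.1 (S.2.2.1 a) - S.2.2.1 (T.2.2.1 a) := rfl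
theorem blockEnd_lie_m2 (T S : BlockEnd k Jp Mp Mm Jm) (a : Jm) :
    ⁅T, S⁆.2.2.2 a = T.2.2.2 (S.2.2.2 a) - S.2.2.2 (T.2.2.2 a) := rfl

set_option maxHeartbeats 1000000 in
theorem tkk_leibniz_2 (p q r : P.TKK) :
    (⁅p, ⁅q, r⁆⁆).1 = (⁅⁅p, q⁆, r⁆ + ⁅q, ⁅p, r⁆⁆ : P.TKK).1 := by
  have hk := fun s : P.TKK => (P.isDer_coe s.2.2.1).1.k
  have hkp : ∀ x a y, P.kp x (P.actp a y) = -P.kp (P.actp a y) x := fun _ _ _ => P.kp_anti _ _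
  simp only [tkk_lie_2, tkk_lie_1, tkk_lie_0, tkk_add_2, map_add, map_sub, hk, hkp,
    LinearMap.add_apply, LinearMap.sub_apply, Prod.fst_add, Prod.fst_sub, delta_2, upsilon_2,
    blockEnd_lie_2]
  rw [P.Dp_comm r.1 p.1, P.Dp_comm q.1 p.1, P.Dp_comm r.1 q.1,
    P.kp_anti (r.2.2.1.1.2.1 p.2.1) q.2.1]
  abel

theorem tkk_leibniz_1 (p q r : P.TKK) :
    (⁅p, ⁅q, r⁆⁆).2.1 = (⁅⁅p, q⁆, r⁆ + ⁅q, ⁅p, r⁆⁆ : P.TKK).2.1 := by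
  have ha := fun s : P.TKK => (P.isDer_coe s.2.2.1).1.act
  simp only [tkk_lie_2, tkk_lie_1, tkk_lie_0, tkk_lie_m1, tkk_add_1, map_add, map_sub, ha,
    LinearMap.add_apply, LinearMap.sub_apply, Prod.fst_add, Prod.fst_sub, Prod.snd_add,
    Prod.snd_sub, delta_1, upsilon_1, blockEnd_lie_1, P.plus.k_act]
  abel

theorem tkk_leibniz_0 (p q r : P.TKK) :
    ((⁅p, ⁅q, r⁆⁆).2.2.1 : BlockEnd k Jp Mp Mm Jm) = (⁅⁅p, q⁆, r⁆ + ⁅q, ⁅p, r⁆⁆ : P.TKK).2.2.1 := by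
  have hd : ∀ s : P.TKK, P.IsDer (s.2.2.1 : BlockEnd k Jp Mp Mm Jm) := fun s => P.isDer_coe _
  have hl : ∀ (s : P.TKK) a b, ⁅(s.2.2.1 : BlockEnd k Jp Mp Mm Jm), P.delta a b⁆ =
      P.delta (s.2.2.1.1.1 a) b + P.delta a (s.2.2.1.1.2.2.2 b) := fun s => (hd s).lie_delta
  have hl' : ∀ (s : P.TKK) a b, ⁅P.delta a b, (s.2.2.1 : BlockEnd k Jp Mp Mm Jm)⁆ =
      -(P.delta (s.2.2.1.1.1 a) b + P.delta a (s.2.2.1.1.2.2.2 b)) := fun s a b => by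
    rw [← hl, lie_skew]
  have hu : ∀ (s : P.TKK) x y, ⁅(s.2.2.1 : BlockEnd k Jp Mp Mm Jm), P.upsilon x y⁆ =
      P.upsilon (s.2.2.1.1.2.1 x) y + P.upsilon x (s.2.2.1.1.2.2.1 y) :=
    fun s => (hd s).lie_upsilon
  have hu' : ∀ (s : P.TKK) x y, ⁅P.upsilon x y, (s.2.2.1 : BlockEnd k Jp Mp Mm Jm)⁆ =
      -(P.upsilon (s.2.2.1.1.2.1 x) y + P.upsilon x (s.2.2.1.1.2.2.1 y)) := fun s a b => by
    rw [← hu, lie_skew]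
  simp only [tkk_lie_2, tkk_lie_1, tkk_lie_0, tkk_lie_m1, tkk_lie_m2, tkk_add_0, map_add,
    map_sub, lie_add, lie_sub, add_lie, sub_lie, hl, hl', hu, hu', delta_k, delta_k',
    LinearMap.add_apply, LinearMap.sub_apply]
  rw [leibniz_lie (p.2.2.1 : BlockEnd k Jp Mp Mm Jm)]
  abel

theorem tkk_leibniz_m1 (p q r : P.TKK) :
    (⁅p, ⁅q, r⁆⁆).2.2.2.1 = (⁅⁅p, q⁆, r⁆ + ⁅q, ⁅p, r⁆⁆ : P.TKK).2.2.2.1 := by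
  have ha' := fun s : P.TKK => (P.isDer_coe s.2.2.1).2.act
  simp only [op, JordanKantorData.op, swap] at ha'
  have hm := P.minus.k_act
  simp only [JordanKantorData.op] at hm
  simp only [tkk_lie_m2, tkk_lie_1, tkk_lie_0, tkk_lie_m1, tkk_add_m1, map_add, map_sub, ha',
    LinearMap.add_apply, LinearMap.sub_apply, Prod.fst_add, Prod.fst_sub, Prod.snd_add,
    Prod.snd_sub, delta_m1, upsilon_m1, blockEnd_lie_m1, hm]
  abel

set_option maxHeartbeats 1000000 in
theorem tkk_leibniz_m2 (p q r : P.TKK) :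
    (⁅p, ⁅q, r⁆⁆).2.2.2.2 = (⁅⁅p, q⁆, r⁆ + ⁅q, ⁅p, r⁆⁆ : P.TKK).2.2.2.2 := by
  have hk' := fun s : P.TKK => (P.isDer_coe s.2.2.1).2.k
  simp only [op, JordanKantorData.op, swap] at hk'
  have hkm : ∀ x a y, P.km x (P.actm a y) = -P.km (P.actm a y) x := fun _ _ _ => P.km_anti _ _
  simp only [tkk_lie_m2, tkk_lie_m1, tkk_lie_0, tkk_add_m2, map_add, map_sub, hk', hkm,
    LinearMap.add_apply, LinearMap.sub_apply, Prod.snd_add, Prod.snd_sub, delta_m2, upsilon_m2,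
    blockEnd_lie_m2]
  rw [P.Dm_comm q.1 r.2.2.2.2 p.2.2.2.2, P.Dm_comm r.1 q.2.2.2.2 p.2.2.2.2,
    P.Dm_comm p.1 r.2.2.2.2 q.2.2.2.2,
    P.km_anti (r.2.2.1.1.2.2.1 p.2.2.2.1) q.2.2.2.1]
  abel

theorem tkk_leibniz (p q r : P.TKK) : ⁅p, ⁅q, r⁆⁆ = ⁅⁅p, q⁆, r⁆ + ⁅q, ⁅p, r⁆⁆ :=
  tkk_ext (tkk_leibniz_2 p q r) (tkk_leibniz_1 p q r) (tkk_leibniz_0 p q r)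
    (tkk_leibniz_m1 p q r) (tkk_leibniz_m2 p q r)

noncomputable instance : LieRing P.TKK where
  add_lie p q r := by
    refine tkk_ext ?_ ?_ ?_ ?_ ?_ <;>
    simp only [tkk_lie_2, tkk_lie_1, tkk_lie_0, tkk_lie_m1, tkk_lie_m2, tkk_add_2, tkk_add_1,
      tkk_add_0, tkk_add_m1, tkk_add_m2, map_add, LinearMap.add_apply, add_lie, Prod.fst_add,
      Prod.snd_add] <;> abel
  lie_add p q r := by
    refine tkk_ext ?_ ?_ ?_ ?_ ?_ <;>
    simp only [tkk_lie_2, tkk_lie_1, tkk_lie_0, tkk_lie_m1, tkk_lie_m2, tkk_add_2, tkk_add_1,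
      tkk_add_0, tkk_add_m1, tkk_add_m2, map_add, LinearMap.add_apply, lie_add, Prod.fst_add,
      Prod.snd_add] <;> abel
  lie_self p := by
    have h := P.minus.k_self
    simp only [JordanKantorData.op] at h
    refine tkk_ext ?_ ?_ ?_ ?_ ?_
    · rw [tkk_lie_2, sub_self, zero_add, P.plus.k_self]; rfl
    · rw [tkk_lie_1, sub_self, zero_add, sub_self]; rfl
    · rw [tkk_lie_0, lie_self, zero_add, add_sub_cancel_left, sub_self]; rfl
    · rw [tkk_lie_m1, sub_self, zero_add, sub_self]; rfl
    · rw [tkk_lie_m2, sub_self, zero_add, h]; rfl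
  leibniz_lie := tkk_leibniz

noncomputable instance : LieAlgebra k P.TKK where
  lie_smul r p q := by
    refine tkk_ext ?_ ?_ ?_ ?_ ?_ <;>
    simp only [tkk_lie_2, tkk_lie_1, tkk_lie_0, tkk_lie_m1, tkk_lie_m2, tkk_smul_2, tkk_smul_1,
      tkk_smul_0, tkk_smul_m1, tkk_smul_m2, map_smul, LinearMap.smul_apply, lie_smul, Prod.smul_fst,
      Prod.smul_snd, smul_add, smul_sub]

variable (P)

/-- The `ℤ`-grading of `TKK(P)`: the elements all of whose components in degrees other than `i` vanish. -/
def tkkGrading (i : ℤ) : Submodule k P.TKK where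
  carrier := {p | (i ≠ 2 → p.1 = 0) ∧ (i ≠ 1 → p.2.1 = 0) ∧ (i ≠ 0 → p.2.2.1 = 0) ∧
    (i ≠ -1 → p.2.2.2.1 = 0) ∧ (i ≠ -2 → p.2.2.2.2 = 0)}
  zero_mem' := ⟨fun _ => rfl, fun _ => rfl, fun _ => rfl, fun _ => rfl, fun _ => rfl⟩
  add_mem' := by
    rintro p q ⟨h1, h2, h3, h4, h5⟩ ⟨g1, g2, g3, g4, g5⟩
    refine ⟨fun h => ?_, fun h => ?_, fun h => ?_, fun h => ?_, fun h => ?_⟩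
    · change p.1 + q.1 = 0; rw [h1 h, g1 h, add_zero]
    · change p.2.1 + q.2.1 = 0; rw [h2 h, g2 h, add_zero]
    · change p.2.2.1 + q.2.2.1 = 0; rw [h3 h, g3 h, add_zero]
    · change p.2.2.2.1 + q.2.2.2.1 = 0; rw [h4 h, g4 h, add_zero]
    · change p.2.2.2.2 + q.2.2.2.2 = 0; rw [h5 h, g5 h, add_zero]
  smul_mem' := by
    rintro r p ⟨h1, h2, h3, h4, h5⟩
    refine ⟨fun h => ?_, fun h => ?_, fun h => ?_, fun h => ?_, fun h => ?_⟩
    · change r • p.1 = 0; rw [h1 h, smul_zero]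
    · change r • p.2.1 = 0; rw [h2 h, smul_zero]
    · change r • p.2.2.1 = 0; rw [h3 h, smul_zero]
    · change r • p.2.2.2.1 = 0; rw [h4 h, smul_zero]
    · change r • p.2.2.2.2 = 0; rw [h5 h, smul_zero]

theorem graded_aux {A B C : Type*} [AddCommGroup A] [AddCommGroup B] [AddCommGroup C]
    (i j m n l : ℤ) (hne : i + j ≠ l) (hl : m + n = l) {f : A → B → C} {s : A} {t : B}
    (hs : i ≠ m → s = 0) (ht : j ≠ n → t = 0) (f1 : ∀ t, f 0 t = 0) (f2 : ∀ s, f s 0 = 0) :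
    f s t = 0 := by
  by_cases hi : i = m
  · have : j ≠ n := by rintro rfl; exact hne (by rw [hi, hl])
    rw [ht this, f2]
  · rw [hs hi, f1]

instance : SetLike.GradedBracket P.tkkGrading where
  bracket_mem := by
    rintro i j ⟨a, x, T, y, b⟩ ⟨c, u, S, w, d⟩ ⟨h1, h2, h3, h4, h5⟩ ⟨g1, g2, g3, g4, g5⟩
    dsimp only at h1 h2 h3 h4 h5 g1 g2 g3 g4 g5
    refine ⟨fun h => ?_, fun h => ?_, fun h => ?_, fun h => ?_, fun h => ?_⟩
    · change T.1.1 c - S.1.1 a + P.kp x u = 0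
      rw [graded_aux i j 0 2 2 h rfl (f := fun (T : P.instr) c => T.1.1 c) h3 g1 (by simp) (by simp),
        graded_aux i j 2 0 2 h rfl (f := fun a (S : P.instr) => S.1.1 a) h1 g3 (by simp) (by simp),
        graded_aux i j 1 1 2 h rfl (f := fun x u => P.kp x u) h2 g2 (by simp) (by simp)]
      simp
    · change T.1.2.1 u - S.1.2.1 x + P.actp a w - P.actp c y = 0
      rw [graded_aux i j 0 1 1 h rfl (f := fun (T : P.instr) c => T.1.2.1 c) h3 g2 (by simp)
          (by simp),
        graded_aux i j 1 0 1 h rfl (f := fun a (S : P.instr) => S.1.2.1 a) h2 g3 (by simp)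
          (by simp),
        graded_aux i j 2 (-1) 1 h rfl (f := fun a w => P.actp a w) h1 g4 (by simp) (by simp),
        graded_aux i j (-1) 2 1 h rfl (f := fun y c => P.actp c y) h4 g1 (by simp) (by simp)]
      simp
    · apply Subtype.ext
      change ⁅T.1, S.1⁆ + P.delta a d + P.upsilon x w - P.delta c b - P.upsilon u y = 0
      rw [graded_aux i j 0 0 0 h rfl (f := fun (T S : P.instr) => ⁅T.1, S.1⁆) h3 g3 (by simp)
          (by simp),
        graded_aux i j 2 (-2) 0 h rfl (f := fun a d => P.delta a d) h1 g5 (by simp) (by simp),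
        graded_aux i j 1 (-1) 0 h rfl (f := fun x w => P.upsilon x w) h2 g4 (by simp) (by simp),
        graded_aux i j (-2) 2 0 h rfl (f := fun b c => P.delta c b) h5 g1 (by simp) (by simp),
        graded_aux i j (-1) 1 0 h rfl (f := fun y u => P.upsilon u y) h4 g2 (by simp) (by simp)]
      simp
    · change T.1.2.2.1 w - S.1.2.2.1 y + P.actm b u - P.actm d x = 0
      rw [graded_aux i j 0 (-1) (-1) h rfl (f := fun (T : P.instr) c => T.1.2.2.1 c) h3 g4 (by simp)
          (by simp),
        graded_aux i j (-1) 0 (-1) h rfl (f := fun a (S : P.instr) => S.1.2.2.1 a) h4 g3 (by simp)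
          (by simp),
        graded_aux i j (-2) 1 (-1) h rfl (f := fun b u => P.actm b u) h5 g2 (by simp) (by simp),
        graded_aux i j 1 (-2) (-1) h rfl (f := fun x d => P.actm d x) h2 g5 (by simp) (by simp)]
      simp
    · change T.1.2.2.2 d - S.1.2.2.2 b + P.km y w = 0
      rw [graded_aux i j 0 (-2) (-2) h rfl (f := fun (T : P.instr) c => T.1.2.2.2 c) h3 g5 (by simp)
          (by simp),
        graded_aux i j (-2) 0 (-2) h rfl (f := fun a (S : P.instr) => S.1.2.2.2 a) h5 g3 (by simp)
          (by simp),
        graded_aux i j (-1) (-1) (-2) h rfl (f := fun y w => P.km y w) h4 g4 (by simp) (by simp)]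
      simp

/-- The inclusion of `J⁺` in `TKK(P)`. -/
noncomputable def tkkJp (a : Jp) : P.TKK := (a, 0, 0, 0, 0)
/-- The inclusion of `M⁺` in `TKK(P)`. -/
noncomputable def tkkMp (x : Mp) : P.TKK := (0, x, 0, 0, 0)
/-- The inclusion of `M⁻` in `TKK(P)`. -/
noncomputable def tkkMm (y : Mm) : P.TKK := (0, 0, 0, y, 0)
/-- The inclusion of `J⁻` in `TKK(P)`. -/
noncomputable def tkkJm (b : Jm) : P.TKK := (0, 0, 0, 0, b)

/-- `P` is perfect: `J^σ = {J^σ J^{-σ} J^σ} + κ(M^σ, M^σ)` and `M^σ = {M^σ M^{-σ} M^σ} + J^σ ∘ M^{-σ}`,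
for both signs `σ`. -/
structure IsPerfect : Prop where
  Jp_eq : Submodule.span k ({c | ∃ a b a', P.Dp a b a' = c} ∪ {c | ∃ x z, P.kp x z = c}) = ⊤
  Jm_eq : Submodule.span k ({c | ∃ a b a', P.Dm a b a' = c} ∪ {c | ∃ x z, P.km x z = c}) = ⊤
  Mp_eq : Submodule.span k ({z | ∃ x y x', P.Vp x y x' = z} ∪ {z | ∃ a y, P.actp a y = z}) = ⊤
  Mm_eq : Submodule.span k ({z | ∃ x y x', P.Vm x y x' = z} ∪ {z | ∃ a y, P.actm a y = z}) = ⊤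

theorem ang_J_mem (a : Jp) (b : Jm) : ang k (P.tkkJp a) (P.tkkJm b) ∈ uceZero P.tkkGrading :=
  ang_mem_uceZero P.tkkGrading 2
    ⟨fun h => absurd rfl h, fun _ => rfl, fun _ => rfl, fun _ => rfl, fun _ => rfl⟩
    ⟨fun _ => rfl, fun _ => rfl, fun _ => rfl, fun _ => rfl, fun h => absurd rfl h⟩

theorem ang_M_mem (x : Mp) (y : Mm) : ang k (P.tkkMp x) (P.tkkMm y) ∈ uceZero P.tkkGrading :=
  ang_mem_uceZero P.tkkGrading 1
    ⟨fun _ => rfl, fun h => absurd rfl h, fun _ => rfl, fun _ => rfl, fun _ => rfl⟩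
    ⟨fun _ => rfl, fun _ => rfl, fun _ => rfl, fun h => absurd rfl h, fun _ => rfl⟩

end JordanKantorPair
end JKP

/-! Write L for TKK(P). The isomorphism is built from two linear maps in opposite directions, each
given by a universal property: `uce(L)` receives alternating 2-cocycles on L, and `uider(P)`
receives pairs of bilinear maps that satisfy its six families of relations.

From `uce(L)` to `uider(P)`, a 2-cocycle on L with values in `uider(P)` is needed. Between degrees
±2 and ±1 it has to be ⋄. On two elements T, S of `instr(P)` it should be T.s, where s is any lift
of S along ud. This does not depend on s: an element p of ker(ud) is annihilated by the whole of
`instr(P)`, because ud is onto and t.p = [t, p] = -[p, t] = -ud(p).t = 0 (`actU_eq_zero`). The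
resulting form is `innerLift`. Its cocycle identity says that `instr(P)` acts on `uider(P)`, and
with the κ-relations it extends to the cocycle identity on L (`cocycle_jacobi`).

From `uider(P)` to `uce(L)`, it must be checked that ⟨a, b⟩ and ⟨x, y⟩ satisfy the relations of
`uider(P)` (`balanced_ang`). Since δ(a, b) = [a, b] in L, the Jacobi relation gives ⟨T, δ(a, b)⟩ =
⟨T.a, b⟩ + ⟨a, T.b⟩, and likewise for v(x, y). The relations inside J and inside M then express that
⟨·, ·⟩ is alternating on `instr(P)`. The two κ-relations are Jacobi relations for triples of degrees
(1, 1, -2) and (2, -1, -1).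

One composite is the identity on the generators of `uider(P)`. For the other, the degree 0 part of
`uce(L)` is spanned by the ⟨p, q⟩ with p, q of opposite degrees. The only ones that are not
generators up to sign are the ⟨T, S⟩ with T, S in `instr(P)`, and for S = ud(s) the formula
`uiderToUce_actU` identifies ⟨T, S⟩ with the image of T.s. Finally u corresponds to ud
(`uceLin_uiderToUce`). Both Lie brackets are defined through these maps, so the bijection is a Lie
homomorphism and matches the two kernels. -/

namespace JKP

/-! ### The universal property of uce(L) as a module -/

section uceLift
variable {k L N : Type*} [CommRing k] [LieRing L] [LieAlgebra k L] [AddCommGroup N] [Module k N]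

/-- The Jacobi relation in Leibniz form: p acts as a derivation on the bracket [q, r]. This is how
symbols with a bracket in one slot are expanded below. -/
theorem ang_lie (p q r : L) : ang k p ⁅q, r⁆ = ang k ⁅p, q⁆ r + ang k q ⁅p, r⁆ := by
  have h := ang_jacobi k p q r
  rw [ang_skew k r, ← lie_skew r p, map_neg] at h
  linear_combination (norm := module) h

/-- An alternating bilinear map as an alternating map of two variables. -/
def altOfBilin (B : L →ₗ[k] L →ₗ[k] N) (hB : ∀ x, B x x = 0) : L [⋀^Fin 2]→ₗ[k] N where
  toFun v := B (v 0) (v 1)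
  map_update_add' v i x y := by
    fin_cases i <;> simp [Function.update]
  map_update_smul' v i r x := by
    fin_cases i <;> simp [Function.update]
  map_eq_zero_of_eq' v i j h hij := by
    fin_cases i <;> fin_cases j <;> simp_all

/-- The linear map on `uce(L)` with `⟨x, y⟩ ↦ B x y`, for an alternating `2`-cocycle `B`. -/
noncomputable def uceLift (B : L →ₗ[k] L →ₗ[k] N) (hB : ∀ x, B x x = 0)
    (hJ : ∀ x y z, B x ⁅y, z⁆ + B y ⁅z, x⁆ + B z ⁅x, y⁆ = 0) : Uce k L →ₗ[k] N :=
  (uceRel k L).liftQ (exteriorPower.alternatingMapLinearEquiv (altOfBilin B hB)) (by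
    rw [uceRel, Submodule.span_le]
    rintro _ ⟨x, y, z, rfl⟩
    simpa [wedge, altOfBilin] using hJ x y z)

@[simp] theorem uceLift_ang (B : L →ₗ[k] L →ₗ[k] N) (hB : ∀ x, B x x = 0)
    (hJ : ∀ x y z, B x ⁅y, z⁆ + B y ⁅z, x⁆ + B z ⁅x, y⁆ = 0) (x y : L) :
    uceLift B hB hJ (ang k x y) = B x y := by
  change (uceRel k L).liftQ _ _ ((uceRel k L).mkQ (wedge k L x y)) = _
  simp [wedge, altOfBilin]

end uceLift

namespace JordanKantorPair
universe v
variable {k : Type v} {Jp Jm Mp Mm : Type*} [CommRing k]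
    [AddCommGroup Jp] [Module k Jp] [AddCommGroup Jm] [Module k Jm]
    [AddCommGroup Mp] [Module k Mp] [AddCommGroup Mm] [Module k Mm]
    (P : JordanKantorPair k Jp Jm Mp Mm)

/-! ### The bracket of uider(P) factors through instr(P) -/

theorem udLin_surjective : Function.Surjective P.udLin := by
  suffices h : ∀ T ∈ Submodule.span k P.innerSet, ∃ p, P.udEnd p = T by
    rintro ⟨T, hT⟩
    obtain ⟨p, hp⟩ := h T hT
    exact ⟨p, Subtype.ext hp⟩
  intro T hT
  change T ∈ LinearMap.range P.udEnd
  revert T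
  change Submodule.span k P.innerSet ≤ LinearMap.range P.udEnd
  rw [Submodule.span_le]
  rintro _ (⟨a, b, rfl⟩ | ⟨x, y, rfl⟩)
  · exact ⟨P.diaJ a b, P.coe_udLin_diaJ a b⟩
  · exact ⟨P.diaM x y, P.coe_udLin_diaM x y⟩

/-- The kernel of ud is central: writing T as ud(t), antisymmetry turns T.p into -ud(p).t, which
vanishes. -/
theorem actU_eq_zero (T : P.instr) {p : P.Uider} (hp : P.udLin p = 0) : P.actU T p = 0 := by
  obtain ⟨t, rfl⟩ := P.udLin_surjective T
  have h := P.actU_skew t p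
  rwa [hp, map_zero, LinearMap.zero_apply, add_zero] at h

/-- The bracket of `uider(P)` as a bilinear map on `instr(P)`, through which it factors. -/
noncomputable def innerLift : P.instr →ₗ[k] P.instr →ₗ[k] P.Uider :=
  -- Two lifts of the same inner derivation differ by an element of ker(ud), on which every T acts
  -- as zero. Hence the form below is linear in its second argument although the chosen section
  -- `Function.surjInv` need not be linear.
  have key (T : P.instr) (p q : P.Uider) (h : P.udLin p = P.udLin q) :
      P.actU T p = P.actU T q := by
    rw [← sub_eq_zero, ← map_sub]
    exact P.actU_eq_zero T (by rw [map_sub, h, sub_self])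
  have hs := Function.surjInv_eq P.udLin_surjective
  LinearMap.mk₂ k (fun T S => P.actU T (Function.surjInv P.udLin_surjective S))
    (fun T T' S => by rw [map_add, LinearMap.add_apply])
    (fun r T S => by rw [map_smul, LinearMap.smul_apply])
    (fun T S S' => by rw [← map_add]; exact key _ _ _ (by rw [map_add, hs, hs, hs]))
    (fun r T S => by rw [← map_smul]; exact key _ _ _ (by rw [map_smul, hs, hs]))

/-- Independence of the chosen lift. All later computations with `innerLift` use this formula in
place of the section. -/
theorem innerLift_udLin (T : P.instr) (p : P.Uider) :
    P.innerLift T (P.udLin p) = P.actU T p := by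
  change P.actU T (Function.surjInv P.udLin_surjective (P.udLin p)) = _
  rw [← sub_eq_zero, ← map_sub]
  exact P.actU_eq_zero T (by rw [map_sub, Function.surjInv_eq P.udLin_surjective, sub_self])

/-- Comes from `actU_self`. Antisymmetry alone would not suffice, since 2 may fail to be invertible
in k. -/
theorem innerLift_self (T : P.instr) : P.innerLift T T = 0 := by
  obtain ⟨t, rfl⟩ := P.udLin_surjective T
  rw [innerLift_udLin, actU_self]

theorem innerLift_skew (T S : P.instr) : P.innerLift T S = -P.innerLift S T := by
  obtain ⟨t, rfl⟩ := P.udLin_surjective T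
  obtain ⟨s, rfl⟩ := P.udLin_surjective S
  rw [innerLift_udLin, innerLift_udLin]
  exact eq_neg_of_add_eq_zero_left (P.actU_skew t s)

theorem innerLift_delta (T : P.instr) (a b) : P.innerLift T ⟨P.delta a b, P.delta_mem a b⟩ =
    P.diaJ (T.1.1 a) b + P.diaJ a (T.1.2.2.2 b) := by
  rw [← actU_diaJ, ← innerLift_udLin]
  congr 1
  exact Subtype.ext (P.coe_udLin_diaJ a b).symm

theorem innerLift_upsilon (T : P.instr) (x y) :
    P.innerLift T ⟨P.upsilon x y, P.upsilon_mem x y⟩ =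
      P.diaM (T.1.2.1 x) y + P.diaM x (T.1.2.2.1 y) := by
  rw [← actU_diaM, ← innerLift_udLin]
  congr 1
  exact Subtype.ext (P.coe_udLin_diaM x y).symm

/-- With R = ud(r) the left side becomes T.(S.r) - S.(T.r) - [T, S].r, so the identity says that the
action of `instr(P)` on `uider(P)` is a representation. Only R has to be lifted. -/
theorem innerLift_jacobi (T S R : P.instr) :
    P.innerLift T ⁅S, R⁆ + P.innerLift S ⁅R, T⁆ + P.innerLift R ⁅T, S⁆ = 0 := by
  obtain ⟨r, rfl⟩ := P.udLin_surjective R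
  rw [P.innerLift_skew (P.udLin r), ← lie_skew _ T, map_neg, ← udLin_actU, ← udLin_actU,
    innerLift_udLin, innerLift_udLin, innerLift_udLin, actU_lie]
  abel

/-! ### A 2-cocycle on TKK(P) with values in uider(P) -/

/-- The cocycle of `TKK(P)` with values in `uider(P)`. -/
noncomputable def cocycle : P.TKK →ₗ[k] P.TKK →ₗ[k] P.Uider :=
  LinearMap.mk₂ k (fun p q => P.diaJ p.1 q.2.2.2.2 - P.diaJ q.1 p.2.2.2.2 +
      P.diaM p.2.1 q.2.2.2.1 - P.diaM q.2.1 p.2.2.2.1 + P.innerLift p.2.2.1 q.2.2.1)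
    (fun p p' q => by
      have h : (p + p').2.2.1 = p.2.2.1 + p'.2.2.1 := rfl
      simp only [tkk_add_2, tkk_add_1, h, tkk_add_m1, tkk_add_m2, map_add, LinearMap.add_apply]
      abel)
    (fun r p q => by
      have h : (r • p).2.2.1 = r • p.2.2.1 := rfl
      simp only [tkk_smul_2, tkk_smul_1, h, tkk_smul_m1, tkk_smul_m2, map_smul,
        LinearMap.smul_apply, smul_add, smul_sub])
    (fun p q q' => by
      have h : (q + q').2.2.1 = q.2.2.1 + q'.2.2.1 := rfl
      simp only [tkk_add_2, tkk_add_1, h, tkk_add_m1, tkk_add_m2, map_add, LinearMap.add_apply]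
      abel)
    (fun r p q => by
      have h : (r • q).2.2.1 = r • q.2.2.1 := rfl
      simp only [tkk_smul_2, tkk_smul_1, h, tkk_smul_m1, tkk_smul_m2, map_smul,
        LinearMap.smul_apply, smul_add, smul_sub])

theorem cocycle_apply (p q : P.TKK) : P.cocycle p q =
    P.diaJ p.1 q.2.2.2.2 - P.diaJ q.1 p.2.2.2.2 +
      P.diaM p.2.1 q.2.2.2.1 - P.diaM q.2.1 p.2.2.2.1 + P.innerLift p.2.2.1 q.2.2.1 := rfl

theorem cocycle_self (p : P.TKK) : P.cocycle p p = 0 := by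
  rw [cocycle_apply, innerLift_self]; abel

/-- The degree 0 component is kept inside `instr(P)`, because `innerLift` takes its arguments there
and not among all block endomorphisms. -/
theorem tkk_lie_0' (p q : P.TKK) : ⁅p, q⁆.2.2.1 = ⁅p.2.2.1, q.2.2.1⁆
    + ⟨P.delta p.1 q.2.2.2.2, P.delta_mem _ _⟩ + ⟨P.upsilon p.2.1 q.2.2.2.1, P.upsilon_mem _ _⟩
    - ⟨P.delta q.1 p.2.2.2.2, P.delta_mem _ _⟩
    - ⟨P.upsilon q.2.1 p.2.2.2.1, P.upsilon_mem _ _⟩ := rfl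

/-- Only triples of homogeneous components with total degree 0 contribute. For degrees (0, 0, 0) the
identity is `innerLift_jacobi`; for (0, m, -m) it is the derivation formula for the action on a ⋄ b
and x ⋄ y; for (1, 1, -2) and (2, -1, -1) it is the two relations of `uider(P)` that involve κ. -/
theorem cocycle_jacobi (p q r : P.TKK) :
    P.cocycle p ⁅q, r⁆ + P.cocycle q ⁅r, p⁆ + P.cocycle r ⁅p, q⁆ = 0 := by
  have B := P.balanced_dia
  have h := P.innerLift_jacobi p.2.2.1 q.2.2.1 r.2.2.1
  simp only [cocycle_apply, tkk_lie_2, tkk_lie_1, tkk_lie_0', tkk_lie_m1, tkk_lie_m2, map_add,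
    map_sub, LinearMap.add_apply, LinearMap.sub_apply, innerLift_delta, innerLift_upsilon, B.r5,
    B.r6]
  linear_combination (norm := abel) h

/-- The linear map `uce(TKK(P)) → uider(P)`. -/
noncomputable def uceToUider : Uce k P.TKK →ₗ[k] P.Uider :=
  uceLift P.cocycle P.cocycle_self P.cocycle_jacobi

theorem uceToUider_ang (p q : P.TKK) : P.uceToUider (ang k p q) = P.cocycle p q :=
  uceLift_ang _ _ _ p q

/-! ### Homogeneous elements of TKK(P) and their brackets -/

/-- The element of `TKK(P)` with the given components. -/
def tkkMk (a : Jp) (x : Mp) (T : P.instr) (y : Mm) (b : Jm) : P.TKK := (a, x, T, y, b)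

section mk
variable (a : Jp) (x : Mp) (T : P.instr) (y : Mm) (b : Jm)
@[simp] theorem tkkMk_2 : (P.tkkMk a x T y b).1 = a := rfl
@[simp] theorem tkkMk_1 : (P.tkkMk a x T y b).2.1 = x := rfl
@[simp] theorem tkkMk_0 : (P.tkkMk a x T y b).2.2.1 = T := rfl
@[simp] theorem tkkMk_m1 : (P.tkkMk a x T y b).2.2.2.1 = y := rfl
@[simp] theorem tkkMk_m2 : (P.tkkMk a x T y b).2.2.2.2 = b := rfl
end mk

theorem tkkMk_add (a a' : Jp) (x x' : Mp) (T T' : P.instr) (y y' : Mm) (b b' : Jm) :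
    P.tkkMk a x T y b + P.tkkMk a' x' T' y' b' =
      P.tkkMk (a + a') (x + x') (T + T') (y + y') (b + b') := rfl

theorem tkkMk_smul (r : k) (a : Jp) (x : Mp) (T : P.instr) (y : Mm) (b : Jm) :
    r • P.tkkMk a x T y b = P.tkkMk (r • a) (r • x) (r • T) (r • y) (r • b) := rfl

/-- The inclusion of `J⁺` in `TKK(P)`, as a linear map. -/
@[simps] noncomputable def tkkJpLin : Jp →ₗ[k] P.TKK where
  toFun t := P.tkkMk t 0 0 0 0
  map_add' s t := by simp [tkkMk_add]
  map_smul' r t := by simp [tkkMk_smul]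

/-- The inclusion of `M⁺` in `TKK(P)`, as a linear map. -/
@[simps] noncomputable def tkkMpLin : Mp →ₗ[k] P.TKK where
  toFun t := P.tkkMk 0 t 0 0 0
  map_add' s t := by simp [tkkMk_add]
  map_smul' r t := by simp [tkkMk_smul]

/-- The inclusion of `instr(P)` in `TKK(P)`, as a linear map. -/
@[simps] noncomputable def tkkInstr : P.instr →ₗ[k] P.TKK where
  toFun t := P.tkkMk 0 0 t 0 0
  map_add' s t := by simp [tkkMk_add]
  map_smul' r t := by simp [tkkMk_smul]

/-- The inclusion of `M⁻` in `TKK(P)`, as a linear map. -/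
@[simps] noncomputable def tkkMmLin : Mm →ₗ[k] P.TKK where
  toFun t := P.tkkMk 0 0 0 t 0
  map_add' s t := by simp [tkkMk_add]
  map_smul' r t := by simp [tkkMk_smul]

/-- The inclusion of `J⁻` in `TKK(P)`, as a linear map. -/
@[simps] noncomputable def tkkJmLin : Jm →ₗ[k] P.TKK where
  toFun t := P.tkkMk 0 0 0 0 t
  map_add' s t := by simp [tkkMk_add]
  map_smul' r t := by simp [tkkMk_smul]

section components
variable (a : Jp) (b : Jm) (x u : Mp) (y w : Mm) (T S : P.instr)

theorem lie_Jp_Jm :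
    ⁅P.tkkJpLin a, P.tkkJmLin b⁆ = P.tkkInstr ⟨P.delta a b, P.delta_mem a b⟩ := by
  refine tkk_ext ?_ ?_ ?_ ?_ ?_ <;>
  simp [tkk_lie_2, tkk_lie_1, tkk_lie_0, tkk_lie_m1, tkk_lie_m2]

theorem lie_Mp_Mm :
    ⁅P.tkkMpLin x, P.tkkMmLin y⁆ = P.tkkInstr ⟨P.upsilon x y, P.upsilon_mem x y⟩ := by
  refine tkk_ext ?_ ?_ ?_ ?_ ?_ <;>
  simp [tkk_lie_2, tkk_lie_1, tkk_lie_0, tkk_lie_m1, tkk_lie_m2]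

theorem lie_instr_Jp : ⁅P.tkkInstr T, P.tkkJpLin a⁆ = P.tkkJpLin (T.1.1 a) := by
  refine tkk_ext ?_ ?_ ?_ ?_ ?_ <;>
  simp [tkk_lie_2, tkk_lie_1, tkk_lie_0, tkk_lie_m1, tkk_lie_m2]

theorem lie_instr_Mp : ⁅P.tkkInstr T, P.tkkMpLin x⁆ = P.tkkMpLin (T.1.2.1 x) := by
  refine tkk_ext ?_ ?_ ?_ ?_ ?_ <;>
  simp [tkk_lie_2, tkk_lie_1, tkk_lie_0, tkk_lie_m1, tkk_lie_m2]

theorem lie_instr_Mm : ⁅P.tkkInstr T, P.tkkMmLin y⁆ = P.tkkMmLin (T.1.2.2.1 y) := by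
  refine tkk_ext ?_ ?_ ?_ ?_ ?_ <;>
  simp [tkk_lie_2, tkk_lie_1, tkk_lie_0, tkk_lie_m1, tkk_lie_m2]

theorem lie_instr_Jm : ⁅P.tkkInstr T, P.tkkJmLin b⁆ = P.tkkJmLin (T.1.2.2.2 b) := by
  refine tkk_ext ?_ ?_ ?_ ?_ ?_ <;>
  simp [tkk_lie_2, tkk_lie_1, tkk_lie_0, tkk_lie_m1, tkk_lie_m2]

theorem lie_Mp_Mp : ⁅P.tkkMpLin x, P.tkkMpLin u⁆ = P.tkkJpLin (P.kp x u) := by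
  refine tkk_ext ?_ ?_ ?_ ?_ ?_ <;>
  simp [tkk_lie_2, tkk_lie_1, tkk_lie_0, tkk_lie_m1, tkk_lie_m2]

theorem lie_Mm_Mm : ⁅P.tkkMmLin y, P.tkkMmLin w⁆ = P.tkkJmLin (P.km y w) := by
  refine tkk_ext ?_ ?_ ?_ ?_ ?_ <;>
  simp [tkk_lie_2, tkk_lie_1, tkk_lie_0, tkk_lie_m1, tkk_lie_m2]

theorem lie_Jp_Mm : ⁅P.tkkJpLin a, P.tkkMmLin y⁆ = P.tkkMpLin (P.actp a y) := by
  refine tkk_ext ?_ ?_ ?_ ?_ ?_ <;>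
  simp [tkk_lie_2, tkk_lie_1, tkk_lie_0, tkk_lie_m1, tkk_lie_m2]

theorem lie_Jm_Mp : ⁅P.tkkJmLin b, P.tkkMpLin x⁆ = P.tkkMmLin (P.actm b x) := by
  refine tkk_ext ?_ ?_ ?_ ?_ ?_ <;>
  simp [tkk_lie_2, tkk_lie_1, tkk_lie_0, tkk_lie_m1, tkk_lie_m2]

end components

/-! ### The map from uider(P) to uce(TKK(P)) -/

/-- `(a, b) ↦ ⟨a, b⟩` -/
noncomputable def angJ : Jp →ₗ[k] Jm →ₗ[k] Uce k P.TKK := (ang k).compl₁₂ P.tkkJpLin P.tkkJmLin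

/-- `(x, y) ↦ ⟨x, y⟩` -/
noncomputable def angM : Mp →ₗ[k] Mm →ₗ[k] Uce k P.TKK := (ang k).compl₁₂ P.tkkMpLin P.tkkMmLin

theorem angJ_apply (a b) : P.angJ a b = ang k (P.tkkJpLin a) (P.tkkJmLin b) := rfl
theorem angM_apply (x y) : P.angM x y = ang k (P.tkkMpLin x) (P.tkkMmLin y) := rfl

/-- Since δ(a, b) is the bracket [a, b] in TKK(P), `ang_lie` lets T act on each factor. The result
has the same shape as the action of T on a ⋄ b. -/
theorem ang_instr_delta (T : P.instr) (a b) :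
    ang k (P.tkkInstr T) (P.tkkInstr ⟨P.delta a b, P.delta_mem a b⟩) =
      P.angJ (T.1.1 a) b + P.angJ a (T.1.2.2.2 b) := by
  rw [← lie_Jp_Jm, ang_lie, lie_instr_Jp, lie_instr_Jm]; rfl

theorem ang_instr_upsilon (T : P.instr) (x y) :
    ang k (P.tkkInstr T) (P.tkkInstr ⟨P.upsilon x y, P.upsilon_mem x y⟩) =
      P.angM (T.1.2.1 x) y + P.angM x (T.1.2.2.1 y) := by
  rw [← lie_Mp_Mm, ang_lie, lie_instr_Mp, lie_instr_Mm]; rfl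

/-- The relations `r1` and `r3` come from ⟨T, T⟩ = 0 for T = v(x, y) and T = δ(a, b). The relations
`r2` and `r4` come from expanding ⟨T, S⟩ = -⟨S, T⟩ on both sides by the derivation formula. For `r5`
and `r6`, the values of κ and ∘ are rewritten as brackets in TKK(P), where one Jacobi relation gives
the claim. -/
theorem balanced_ang : P.Balanced P.angJ P.angM where
  r1 x y := by
    have h := P.ang_instr_upsilon ⟨P.upsilon x y, P.upsilon_mem x y⟩ x y
    rw [ang_self] at h
    simp only [upsilon_1, upsilon_m1, map_neg] at h
    linear_combination (norm := module) h
  r2 x y u w := by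
    have h := P.ang_instr_upsilon ⟨P.upsilon x y, P.upsilon_mem x y⟩ u w
    rw [ang_skew, P.ang_instr_upsilon] at h
    simp only [upsilon_1, upsilon_m1, map_neg] at h
    linear_combination (norm := module) -h
  r3 a b := by
    have h := P.ang_instr_delta ⟨P.delta a b, P.delta_mem a b⟩ a b
    rw [ang_self] at h
    simp only [delta_2, delta_m2, map_neg] at h
    linear_combination (norm := module) h
  r4 a b c d := by
    have h := P.ang_instr_delta ⟨P.delta a b, P.delta_mem a b⟩ c d
    rw [ang_skew, P.ang_instr_delta] at h
    simp only [delta_2, delta_m2, map_neg] at h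
    -- The action of δ(c, d) on b produces {d, c, b}, whereas the relation is written with {b, c,
    -- d}.
    rw [P.Dm_comm c b d]
    linear_combination (norm := module) -h
  r5 u x b := by
    simp only [angJ_apply, angM_apply, ← lie_Mp_Mp, ← lie_Jm_Mp]
    rw [ang_skew, ang_lie, ang_skew k ⁅P.tkkJmLin b, P.tkkMpLin u⁆]
    abel
  r6 a y w := by
    simp only [angJ_apply, angM_apply, ← lie_Mm_Mm, ← lie_Jp_Mm]
    rw [ang_lie, ang_skew k (P.tkkMmLin y)]
    abel

/-- The linear map `uider(P) → uce(TKK(P))` with `a ⋄ b ↦ ⟨a, b⟩` and `x ⋄ y ↦ ⟨x, y⟩`. -/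
noncomputable def uiderToUce : P.Uider →ₗ[k] Uce k P.TKK := P.balanced_ang.lift

@[simp] theorem uiderToUce_diaJ (a b) : P.uiderToUce (P.diaJ a b) = P.angJ a b :=
  P.balanced_ang.lift_diaJ a b

@[simp] theorem uiderToUce_diaM (x y) : P.uiderToUce (P.diaM x y) = P.angM x y :=
  P.balanced_ang.lift_diaM x y

/-! ### The two maps are mutually inverse in degree 0 -/

@[simp] theorem uceToUider_angJ (a b) : P.uceToUider (P.angJ a b) = P.diaJ a b := by
  simp [angJ_apply, uceToUider_ang, cocycle_apply]

@[simp] theorem uceToUider_angM (x y) : P.uceToUider (P.angM x y) = P.diaM x y := by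
  simp [angM_apply, uceToUider_ang, cocycle_apply]

theorem uceToUider_uiderToUce (p : P.Uider) : P.uceToUider (P.uiderToUce p) = p := by
  induction p using uider_induction with
  | hJ a b => simp
  | hM x y => simp
  | h0 => simp only [map_zero]
  | hadd p q hp hq => simp only [map_add, hp, hq]

theorem uiderToUce_mem (p : P.Uider) : P.uiderToUce p ∈ uceZero P.tkkGrading := by
  induction p using uider_induction with
  | hJ a b => rw [uiderToUce_diaJ]; exact P.ang_J_mem a b
  | hM x y => rw [uiderToUce_diaM]; exact P.ang_M_mem x y
  | h0 => rw [map_zero]; exact zero_mem _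
  | hadd p q hp hq => rw [map_add]; exact add_mem hp hq

/-- Brings symbols with both entries in degree 0 into the image of `uider(P)`. It holds on
generators because the action on `uider(P)` and the expansion of ⟨T, δ(a, b)⟩ or ⟨T, v(x, y)⟩ are
given by the same formula. -/
theorem uiderToUce_actU (T : P.instr) (p : P.Uider) :
    P.uiderToUce (P.actU T p) = ang k (P.tkkInstr T) (P.tkkInstr (P.udLin p)) := by
  induction p using uider_induction with
  | hJ a b =>
    have e : P.udLin (P.diaJ a b) = ⟨P.delta a b, P.delta_mem a b⟩ :=
      Subtype.ext (P.coe_udLin_diaJ a b)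
    rw [e, ang_instr_delta, actU_diaJ, map_add, uiderToUce_diaJ, uiderToUce_diaJ]
  | hM x y =>
    have e : P.udLin (P.diaM x y) = ⟨P.upsilon x y, P.upsilon_mem x y⟩ :=
      Subtype.ext (P.coe_udLin_diaM x y)
    rw [e, ang_instr_upsilon, actU_diaM, map_add, uiderToUce_diaM, uiderToUce_diaM]
  | h0 => simp only [map_zero]
  | hadd p q hp hq => simp only [map_add, hp, hq]

/-- Under the map into `uce(TKK(P))`, u restricts to ud followed by the inclusion of `instr(P)`.
Both the compatibility with brackets and the comparison of kernels rest on this. -/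
theorem uceLin_uiderToUce (p : P.Uider) :
    uceLin k P.TKK (P.uiderToUce p) = P.tkkInstr (P.udLin p) := by
  induction p using uider_induction with
  | hJ a b =>
    rw [uiderToUce_diaJ, angJ_apply, uceLin_ang, lie_Jp_Jm]
    exact congrArg _ (Subtype.ext (P.coe_udLin_diaJ a b).symm)
  | hM x y =>
    rw [uiderToUce_diaM, angM_apply, uceLin_ang, lie_Mp_Mm]
    exact congrArg _ (Subtype.ext (P.coe_udLin_diaM x y).symm)
  | h0 => simp only [map_zero]
  | hadd p q hp hq => simp only [map_add, hp, hq]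

/-- By definition [p, q] is ud(p).q on one side and [X, Y] is ⟨u(X), u(Y)⟩ on the other; both become
⟨ud(p), ud(q)⟩. -/
theorem uiderToUce_lie (p q : P.Uider) :
    P.uiderToUce ⁅p, q⁆ = ⁅P.uiderToUce p, P.uiderToUce q⁆ := by
  change P.uiderToUce (P.actU _ _) = ang k (uceLin k _ _) (uceLin k _ _)
  rw [uiderToUce_actU, uceLin_uiderToUce, uceLin_uiderToUce]

theorem tkk_eq_sum (p : P.TKK) : p = P.tkkJpLin p.1 + P.tkkMpLin p.2.1 + P.tkkInstr p.2.2.1 +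
    P.tkkMmLin p.2.2.2.1 + P.tkkJmLin p.2.2.2.2 := by
  refine tkk_ext ?_ ?_ ?_ ?_ ?_ <;>
  simp [tkkMk_add]

/-- For m = ±1, ±2 the symbol is, up to sign, one of the ⟨x, y⟩ or ⟨a, b⟩, which are fixed by
construction. The substantial case is m = 0, where q is lifted to `uider(P)`. -/
theorem uiderToUce_uceToUider_ang {p q : P.TKK} {m : ℤ} (hp : p ∈ P.tkkGrading m)
    (hq : q ∈ P.tkkGrading (-m)) : P.uiderToUce (P.uceToUider (ang k p q)) = ang k p q := by
  have hJ (a b) : P.uiderToUce (P.uceToUider (P.angJ a b)) = P.angJ a b := by simp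
  have hM (x y) : P.uiderToUce (P.uceToUider (P.angM x y)) = P.angM x y := by simp
  obtain ⟨h1, h2, h3, h4, h5⟩ := hp
  obtain ⟨g1, g2, g3, g4, g5⟩ := hq
  have ep := P.tkk_eq_sum p
  have eq := P.tkk_eq_sum q
  by_cases m2 : m = 2
  · subst m2
    rw [h2 (by decide), h3 (by decide), h4 (by decide), h5 (by decide)] at ep
    rw [g1 (by decide), g2 (by decide), g3 (by decide), g4 (by decide)] at eq
    simp only [map_zero, add_zero, zero_add] at ep eq
    rw [ep, eq]
    exact hJ _ _
  by_cases n2 : m = -2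
  · subst n2
    rw [h1 (by decide), h2 (by decide), h3 (by decide), h4 (by decide)] at ep
    rw [g2 (by decide), g3 (by decide), g4 (by decide), g5 (by decide)] at eq
    simp only [map_zero, add_zero, zero_add] at ep eq
    rw [ep, eq, ang_skew, map_neg, map_neg]
    exact congrArg _ (hJ _ _)
  by_cases m1 : m = 1
  · subst m1
    rw [h1 (by decide), h3 (by decide), h4 (by decide), h5 (by decide)] at ep
    rw [g1 (by decide), g2 (by decide), g3 (by decide), g5 (by decide)] at eq
    simp only [map_zero, add_zero, zero_add] at ep eq
    rw [ep, eq]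
    exact hM _ _
  by_cases n1 : m = -1
  · subst n1
    rw [h1 (by decide), h2 (by decide), h3 (by decide), h5 (by decide)] at ep
    rw [g1 (by decide), g3 (by decide), g4 (by decide), g5 (by decide)] at eq
    simp only [map_zero, add_zero, zero_add] at ep eq
    rw [ep, eq, ang_skew, map_neg, map_neg]
    exact congrArg _ (hM _ _)
  -- What remains is m = 0 together with |m| > 2. In all of these only the `instr(P)` components can
  -- be nonzero, so one argument covers them.
  rw [h1 m2, h2 m1, h4 n1, h5 n2] at ep
  rw [g1 (by omega), g2 (by omega), g4 (by omega), g5 (by omega)] at eq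
  simp only [map_zero, add_zero, zero_add] at ep eq
  rw [ep, eq, uceToUider_ang]
  -- With the lift s, the cocycle takes the value T.s, and `uiderToUce_actU` sends it back to ⟨T,
  -- ud(s)⟩.
  obtain ⟨s, hs⟩ := P.udLin_surjective q.2.2.1
  simp only [cocycle_apply, tkkInstr_apply, tkkMk_2, tkkMk_1, tkkMk_0, tkkMk_m1, tkkMk_m2,
    map_zero, sub_zero, zero_add]
  rw [← hs, innerLift_udLin, uiderToUce_actU, tkkInstr_apply, tkkInstr_apply]

/-- The locus where a linear endomorphism agrees with the identity is a submodule, so it is enough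
to treat the spanning symbols of opposite degrees. -/
theorem uiderToUce_uceToUider {X : Uce k P.TKK} (hX : X ∈ uceZero P.tkkGrading) :
    P.uiderToUce (P.uceToUider X) = X := by
  have h : uceGrading P.tkkGrading 0 ≤
      LinearMap.eqLocus (P.uiderToUce ∘ₗ P.uceToUider) LinearMap.id := by
    refine iSup_le fun m => ?_
    rw [Submodule.span_le]
    rintro _ ⟨p, hp, q, hq, rfl⟩
    rw [zero_sub] at hq
    exact P.uiderToUce_uceToUider_ang hp hq
  exact h hX

/-! ### The isomorphism and its restriction to the kernels -/

/-- The isomorphism `uider(P) ≅ uce(TKK(P))₀`. -/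
noncomputable def uiderEquiv : P.Uider ≃ₗ⁅k⁆ uceZero P.tkkGrading where
  toFun p := ⟨P.uiderToUce p, P.uiderToUce_mem p⟩
  map_add' p q := Subtype.ext (map_add P.uiderToUce p q)
  map_smul' r p := Subtype.ext (map_smul P.uiderToUce r p)
  map_lie' {p q} := Subtype.ext (P.uiderToUce_lie p q)
  invFun X := P.uceToUider X
  left_inv p := P.uceToUider_uiderToUce p
  right_inv X := Subtype.ext (P.uiderToUce_uceToUider X.2)

theorem uceToUider_mem_HC {X : Uce k P.TKK} (hX : X ∈ uceKerZero P.tkkGrading) :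
    P.uceToUider X ∈ P.HC := by
  have h0 : uceLin k P.TKK X = 0 := ((LieSubalgebra.mem_inf _ _ _).1 hX).1
  -- As X has degree 0, it is the image of its own image p in `uider(P)`. Thus u(X) = 0 says that
  -- ud(p) vanishes as an element of TKK(P), and its degree 0 component gives ud(p) = 0.
  rw [← P.uiderToUce_uceToUider (mem_uceZero_of_mem _ hX), uceLin_uiderToUce] at h0
  exact congrArg (fun p : P.TKK => p.2.2.1) h0

theorem uiderToUce_mem_uceKerZero {p : P.Uider} (hp : p ∈ P.HC) :
    P.uiderToUce p ∈ uceKerZero P.tkkGrading := by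
  refine (LieSubalgebra.mem_inf _ _ _).2 ⟨?_, P.uiderToUce_mem p⟩
  change uceLin k P.TKK (P.uiderToUce p) = 0
  have h : P.udLin p = 0 := hp
  rw [uceLin_uiderToUce, h, map_zero]

/-- The isomorphism `HC(P) ≅ (ker u)₀`. -/
noncomputable def hcEquiv : P.HC ≃ₗ⁅k⁆ uceKerZero P.tkkGrading where
  toFun p := ⟨P.uiderToUce p, P.uiderToUce_mem_uceKerZero p.2⟩
  map_add' p q := Subtype.ext (map_add P.uiderToUce p.1 q.1)
  map_smul' r p := Subtype.ext (map_smul P.uiderToUce r p.1)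
  map_lie' {p q} := Subtype.ext (P.uiderToUce_lie p.1 q.1)
  invFun X := ⟨P.uceToUider X, P.uceToUider_mem_HC X.2⟩
  left_inv p := Subtype.ext (P.uceToUider_uiderToUce p)
  right_inv X := Subtype.ext (P.uiderToUce_uceToUider (mem_uceZero_of_mem _ X.2))

end JordanKantorPair
end JKP

theorem mainTheorem2 {k Jp Jm Mp Mm : Type*} [CommRing k]
    [AddCommGroup Jp] [Module k Jp] [AddCommGroup Jm] [Module k Jm]
    [AddCommGroup Mp] [Module k Mp] [AddCommGroup Mm] [Module k Mm]
    (P : JKP.JordanKantorPair k Jp Jm Mp Mm) (hP : P.IsPerfect) :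
    ∃ φ : JKP.uceZero P.tkkGrading ≃ₗ⁅k⁆ P.Uider,
      (∀ (a : Jp) (b : Jm),
        φ ⟨JKP.ang k (P.tkkJp a) (P.tkkJm b), P.ang_J_mem a b⟩ = P.diaJ a b) ∧
      (∀ (x : Mp) (y : Mm),
        φ ⟨JKP.ang k (P.tkkMp x) (P.tkkMm y), P.ang_M_mem x y⟩ = P.diaM x y) ∧
      ∃ ψ : JKP.uceKerZero P.tkkGrading ≃ₗ⁅k⁆ P.HC,
        ∀ X : JKP.uceKerZero P.tkkGrading,
          (ψ X : P.Uider) = φ ⟨X, JKP.mem_uceZero_of_mem P.tkkGrading X.2⟩ := by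
  -- The inclusions `tkkJp`, `tkkMp`, `tkkMm`, `tkkJm` agree by definition with their linear
  -- versions. Both inverse equivalences are restrictions of `uceToUider`, so ψ agrees with φ by
  -- `rfl`.
  refine ⟨P.uiderEquiv.symm, fun a b => P.uceToUider_angJ a b, fun x y => P.uceToUider_angM x y,
    P.hcEquiv.symm, fun X => rfl⟩
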